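/- **Setting.** Let $\Sigma$ be a finite set of signals, $\Delta_\Sigma$ the set of probability distributions on $\Sigma$. There is an infinite group of agents: a set $I$ with a probability measure $\lambda$ (the uniform distribution over the agents) for which every single agent has weight $0$. All agents share a common prior $\Pr$, under which there is a state of the world $W$ with values in $\Delta_\Sigma$ such that, given $W=\omega$, the agents' private signals $\Psi_i$ are i.i.d. with distribution $\omega$ (so the prior is symmetric). Let $q_\sigma\in\Delta_\Sigma$ be the posterior expectation, for an agent with signal $\sigma$, of the fractions of agents receiving each signal. Each agent $i$ reports a signal $\hat\sigma_i\in\Sigma$ and a prediction $\hat p_i\in\Delta_\Sigma$. A strategy maps the private signal to a probability distribution over reports; agents randomize independently, and strategy profiles depend measurably on the agent. Truth-telling is the report $(\sigma_i,q_{\sigma_i})$. Let $\hat W$ be the random distribution over the agents' reported signals, characterized up to null events by $\mathbb E[\mathbf 1_A\hat W(\tau)]=\int_I\Pr[A,\ \hat\sigma_k=\tau]\,d\lambda(k)$ for all events $A$ and $\tau\in\Sigma$. Let $\hat\Psi$ be the reported signal of an agent drawn from $\lambda$, and let $I(\cdot\,;\cdot\mid\cdot)$ denote conditional Shannon mutual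 information. In BTS($\alpha$), agent $i$ is matched with a reference agent $j$ drawn from $\lambda$ and paid (prediction score) $+\ \alpha\,\cdot$ (information score), where $$\text{prediction score}=\log\hat p_i(\hat\sigma_j)-\log\hat W(\hat\sigma_j),\qquad \text{information score}=\log\hat W(\hat\sigma_i)-\log\hat p_j(\hat\sigma_i),$$ with $\log 0=-\infty$ and $(-\infty)-(-\infty)=-\infty$. Expectations take values in $[-\infty,\infty]$; an expectation whose positive and negative parts are both infinite, and a sum $(+\infty)+(-\infty)$, is given the value $-\infty$. The expected payment is the expected prediction score plus $\alpha$ times the expected information score. An equilibrium is a strategy profile under which every agent's expected payment is finite and no agent can increase her expected payment by changing her strategy. Averages over agents are taken with respect to $\lambda$, and the agent welfare is the $\lambda$-average (total weight $1$) of the expected payments. **Theorem.** 1. When everyone tells the truth, $\hat W=W$ almost surely, and for all $i\ne j$ agent $i$'s expected information score and expected prediction score are $I(W;\Psi_i\mid\Psi_j)$ and $-I(W;\Psi_j\mid\Psi_i)$. 2. For every $\alpha>0$, every equilibrium of BTS($\alpha$) and all agents $i,j$, the expected average information score is $I(\hat W;\hat\Psi\mid\Psi_j)$ and the expected average prediction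 score is $-I(\hat W;\hat\Psi\mid\Psi_i)$. 3. For every $\alpha>0$, truth-telling is an equilibrium of BTS($\alpha$), and it maximizes the expected average information score over all equilibria. 4. For every $\alpha>1$, BTS($\alpha$) is focal: truth-telling is an equilibrium and maximizes the agent welfare over all equilibria. -/

import Mathlib

open MeasureTheory ProbabilityTheory Set Filter

/-! ## Extended expectations and Shannon mutual information -/

/-- The expectation of an extended real random variable: the mean of the positive part minus the
mean of the negative part. If both are infinite the value is `⊥`. -/
noncomputable def emean {X : Type*} [MeasurableSpace X] (μ : Measure X) (f : X → EReal) : EReal :=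
  ((∫⁻ x, (f x).toENNReal ∂μ : ENNReal) : EReal) - ((∫⁻ x, (-f x).toENNReal ∂μ : ENNReal) : EReal)

/-- Shannon mutual information of a pair with joint law `ν`: the Kullback-Leibler divergence between
the joint law and the product of its marginals. -/
noncomputable def mutualInfo {X Y : Type*} [MeasurableSpace X] [MeasurableSpace Y]
    (ν : Measure (X × Y)) : ENNReal :=
  InformationTheory.klDiv ν (ν.fst.prod ν.snd)

/-- Conditional Shannon mutual information `I(X; Y | Z) = ∑ z, Pr[Z = z] * I(X; Y | Z = z)` for a
triple `(X, Y, Z)` with joint law `m`, where `Z` takes finitely many values. -/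
noncomputable def condMutualInfo {X Y Z : Type*} [MeasurableSpace X] [MeasurableSpace Y]
    [MeasurableSpace Z] [Fintype Z] (m : Measure (X × Y × Z)) : ENNReal :=
  ∑ z : Z, m {p | p.2.2 = z} *
    mutualInfo ((m[|{p | p.2.2 = z}]).map (fun p => (p.1, p.2.1)))

namespace BTS

/-! ## Reports, scores and strategies -/

/-- `Δ_S`, the probability distributions over the finite signal set `S`. -/
abbrev Simplex (S : Type*) [Fintype S] : Type _ := stdSimplex ℝ S

/-- A report: a signal and a prediction. -/
abbrev Report (S : Type*) [Fintype S] : Type _ := S × Simplex S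

/-- The logarithm of a number in `[0, 1]`, with `log 0 = -∞`. -/
noncomputable def elog (p : ℝ) : EReal := ENNReal.log (ENNReal.ofReal p)

/-- The prediction score of an agent with report `r` and reference report `r'`, when `fr` is the
distribution of the reported signals. -/
noncomputable def scorePre {S : Type*} [Fintype S] (fr : Simplex S) (r r' : Report S) : EReal :=
  elog (r.2.1 r'.1) - elog (fr.1 r'.1)

/-- The information score of an agent with report `r` and reference report `r'`, when `fr` is the
distribution of the reported signals. -/
noncomputable def scoreIm {S : Type*} [Fintype S] (fr : Simplex S) (r r' : Report S) : EReal :=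
  elog (fr.1 r.1) - elog (r'.2.1 r.1)

/-- A strategy of one agent: for each private signal a probability distribution over reports,
realized as the law of a measurable function of a private uniform seed. -/
structure Strategy (S : Type*) [Fintype S] [MeasurableSpace S] where
  toFun : S → unitInterval → Report S
  measurable_toFun : ∀ σ, Measurable (toFun σ)

/-- A strategy profile, measurable in the agent. -/
structure Profile (I S : Type*) [MeasurableSpace I] [Fintype S] [MeasurableSpace S] where
  toFun : I → S → unitInterval → Report S
  measurable_toFun : ∀ σ, Measurable fun p : I × unitInterval => toFun p.1 σ p.2

/-- The strategy of agent `i` in a profile. -/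
def Profile.strategy {I S : Type*} [MeasurableSpace I] [Fintype S] [MeasurableSpace S]
    (s : Profile I S) (i : I) : Strategy S where
  toFun := s.toFun i
  measurable_toFun σ := (s.measurable_toFun σ).comp measurable_prodMk_left

/-- The information environment. The infinite group of agents is a set `I` with a
probability `pop`, the uniform distribution over the agents, in which each agent has weight zero. All agents share the prior `P`. Given
the state of the world `W`, the private signals `Ψ i` are independent with distribution `W`; each
agent also has a private uniform seed `U i` for randomizing her report. -/
structure Environment (I Ω S : Type*) [MeasurableSpace I] [MeasurableSpace Ω] [Fintype S]
    [MeasurableSpace S] where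
  pop : Measure I
  isProb_pop : IsProbabilityMeasure pop
  null_agent : NullSingletonClass pop
  P : Measure Ω
  isProb_P : IsProbabilityMeasure P
  W : Ω → Simplex S
  measurable_W : Measurable W
  Ψ : I → Ω → S
  measurable_Ψ : ∀ i, Measurable (Ψ i)
  U : I → Ω → unitInterval
  measurable_U : ∀ i, Measurable (U i)
  cond_iid : ∀ (F : Finset I) (σ : I → S) (A : I → Set unitInterval) (B : Set (Simplex S)),
    (∀ i, MeasurableSet (A i)) → MeasurableSet B →
    P (W ⁻¹' B ∩ ⋂ i ∈ F, {x | Ψ i x = σ i ∧ U i x ∈ A i}) =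
      ∫⁻ x in W ⁻¹' B, ∏ i ∈ F, (ENNReal.ofReal ((W x).1 (σ i)) * volume (A i)) ∂P

namespace Environment

attribute [instance] isProb_pop null_agent isProb_P

variable {I Ω S : Type*} [MeasurableSpace I] [MeasurableSpace Ω] [Fintype S] [MeasurableSpace S]

/-- The report of agent `i` when she plays `t`. -/
def report (E : Environment I Ω S) (t : Strategy S) (i : I) (x : Ω) : Report S :=
  t.toFun (E.Ψ i x) (E.U i x)

/-- `V` is the distribution over the agents' reported signals under the profile `s`: for every
event `A` and signal `τ`, the expectation over `A` of the fraction `V τ` of agents reporting `τ` is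
the probability that `A` occurs and a uniformly random agent, drawn independently of everything
else, reports `τ`. (The population average of the indicators of `agent k reports τ` is a Pettis
integral, since for a continuum of conditionally independent reports the realized indicator need
not be measurable in the agent.) -/
structure IsReportDistribution (E : Environment I Ω S) (s : Profile I S) (V : Ω → Simplex S) :
    Prop where
  measurable : Measurable V
  average : ∀ (τ : S) (A : Set Ω), MeasurableSet A →
    ∫⁻ x in A, ENNReal.ofReal ((V x).1 τ) ∂E.P =
      ∫⁻ k, E.P (A ∩ {x | (E.report (s.strategy k) k x).1 = τ}) ∂E.pop


section Existence

set_option linter.unusedSectionVars false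

variable [MeasurableSingletonClass S]

/-- The probability that agent `k` reports `τ` under `s`, as a function of the state. -/
noncomputable def reportProb (s : Profile I S) (k : I) (τ : S) (w : Simplex S) : ENNReal :=
  ∑ ρ, ENNReal.ofReal (w.1 ρ) * volume {u | (s.toFun k ρ u).1 = τ}

theorem measurable_coord (τ : S) : Measurable fun w : Simplex S => ENNReal.ofReal (w.1 τ) :=
  ENNReal.measurable_ofReal.comp ((measurable_pi_apply τ).comp measurable_subtype_coe)

theorem measurable_reportProb (s : Profile I S) (k : I) (τ : S) :
    Measurable (reportProb s k τ) :=
  Finset.measurable_sum _ fun ρ _ => (measurable_coord ρ).mul_const _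

theorem sum_coord (w : Simplex S) : ∑ ρ, ENNReal.ofReal (w.1 ρ) = 1 := by
  rw [← ENNReal.ofReal_sum_of_nonneg (fun i _ => w.2.1 i), w.2.2, ENNReal.ofReal_one]

theorem reportProb_le_one (s : Profile I S) (k : I) (τ : S) (w : Simplex S) :
    reportProb s k τ w ≤ 1 := by
  rw [← sum_coord w]
  refine Finset.sum_le_sum fun ρ _ => ?_
  exact mul_le_of_le_one_right' prob_le_one

theorem measurableSet_seed (s : Profile I S) (k : I) (ρ τ : S) :
    MeasurableSet {u | (s.toFun k ρ u).1 = τ} :=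
  (measurable_fst.comp ((s.strategy k).measurable_toFun ρ)) (measurableSet_singleton τ)

theorem measurableSet_atom (E : Environment I Ω S) (k : I) (ρ : S) {A : Set unitInterval}
    (hA : MeasurableSet A) : MeasurableSet {x | E.Ψ k x = ρ ∧ E.U k x ∈ A} :=
  (E.measurable_Ψ k (measurableSet_singleton ρ)).inter (E.measurable_U k hA)

theorem report_event (E : Environment I Ω S) (s : Profile I S) (k : I) (τ : S) :
    {x | (E.report (s.strategy k) k x).1 = τ} =
      ⋃ ρ : S, {x | E.Ψ k x = ρ ∧ E.U k x ∈ {u | (s.toFun k ρ u).1 = τ}} := by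
  ext x
  simp [report, Profile.strategy]

theorem report_event_inter (E : Environment I Ω S) (s : Profile I S) (k : I) (τ : S)
    {A : Set Ω} (hA : MeasurableSet A) :
    E.P (A ∩ {x | (E.report (s.strategy k) k x).1 = τ}) =
      ∑ ρ : S, E.P (A ∩ {x | E.Ψ k x = ρ ∧ E.U k x ∈ {u | (s.toFun k ρ u).1 = τ}}) := by
  rw [report_event, inter_iUnion, measure_iUnion, tsum_fintype]
  · intro ρ ρ' h
    refine Set.disjoint_left.2 fun x hx hx' => h ?_
    exact hx.2.1.symm.trans hx'.2.1
  · exact fun ρ => hA.inter (E.measurableSet_atom k ρ (measurableSet_seed s k ρ τ))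

theorem measurableSet_report (E : Environment I Ω S) (s : Profile I S) (k : I) (τ : S) :
    MeasurableSet {x | (E.report (s.strategy k) k x).1 = τ} := by
  rw [report_event]
  exact MeasurableSet.iUnion fun ρ => E.measurableSet_atom k ρ (measurableSet_seed s k ρ τ)

theorem single_law (E : Environment I Ω S) (k : I) (ρ : S) {A : Set unitInterval}
    (hA : MeasurableSet A) {B : Set (Simplex S)} (hB : MeasurableSet B) :
    E.P (E.W ⁻¹' B ∩ {x | E.Ψ k x = ρ ∧ E.U k x ∈ A}) =
      ∫⁻ x in E.W ⁻¹' B, ENNReal.ofReal ((E.W x).1 ρ) * volume A ∂E.P := by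
  simpa using E.cond_iid {k} (fun _ => ρ) (fun _ => A) B (fun _ => hA) hB

theorem pair_law (E : Environment I Ω S) {k l : I} (hkl : k ≠ l) (ρ ρ' : S)
    {A A' : Set unitInterval} (hA : MeasurableSet A) (hA' : MeasurableSet A') :
    E.P ({x | E.Ψ k x = ρ ∧ E.U k x ∈ A} ∩ {x | E.Ψ l x = ρ' ∧ E.U l x ∈ A'}) =
      ∫⁻ x, (ENNReal.ofReal ((E.W x).1 ρ) * volume A) *
        (ENNReal.ofReal ((E.W x).1 ρ') * volume A') ∂E.P := by
  classical
  have h := E.cond_iid {k, l} (fun i => if i = k then ρ else ρ')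
    (fun i => if i = k then A else A') univ (fun i => by split_ifs <;> assumption)
    MeasurableSet.univ
  simpa [hkl, hkl.symm, Finset.prod_pair] using h

theorem report_law (E : Environment I Ω S) (s : Profile I S) (k : I) (τ : S)
    {B : Set (Simplex S)} (hB : MeasurableSet B) :
    E.P (E.W ⁻¹' B ∩ {x | (E.report (s.strategy k) k x).1 = τ}) =
      ∫⁻ x in E.W ⁻¹' B, reportProb s k τ (E.W x) ∂E.P := by
  rw [report_event_inter _ _ _ _ (E.measurable_W hB)]
  simp only [reportProb]
  rw [lintegral_finsetSum]
  · exact Finset.sum_congr rfl fun ρ _ => E.single_law k ρ (measurableSet_seed s k ρ τ) hB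
  · exact fun ρ _ => ((measurable_coord ρ).comp E.measurable_W).mul_const _

theorem report_pair_law (E : Environment I Ω S) (s : Profile I S) {k l : I} (hkl : k ≠ l)
    (τ : S) :
    E.P ({x | (E.report (s.strategy k) k x).1 = τ} ∩
        {x | (E.report (s.strategy l) l x).1 = τ}) =
      ∫⁻ x, reportProb s k τ (E.W x) * reportProb s l τ (E.W x) ∂E.P := by
  have hm : ∀ ρ : S, Measurable fun x => ENNReal.ofReal ((E.W x).1 ρ) :=
    fun ρ => (measurable_coord ρ).comp E.measurable_W
  rw [report_event_inter _ _ _ _ (E.measurableSet_report s k τ)]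
  simp only [reportProb, Finset.sum_mul_sum]
  have hmm : ∀ ρ ρ' : S, Measurable fun x =>
      ENNReal.ofReal ((E.W x).1 ρ) * volume {u | (s.toFun k ρ u).1 = τ} *
        (ENNReal.ofReal ((E.W x).1 ρ') * volume {u | (s.toFun l ρ' u).1 = τ}) :=
    fun ρ ρ' => ((hm ρ).mul_const _).mul ((hm ρ').mul_const _)
  rw [lintegral_finsetSum _ fun i _ => Finset.measurable_sum _ fun j _ => hmm i j]
  rw [Finset.sum_congr rfl fun i _ => lintegral_finsetSum _ fun j _ => hmm i j]
  rw [Finset.sum_comm]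
  refine Finset.sum_congr rfl fun ρ' _ => ?_
  rw [inter_comm, report_event_inter _ _ _ _
    (E.measurableSet_atom l ρ' (measurableSet_seed s l ρ' τ))]
  refine Finset.sum_congr rfl fun ρ _ => ?_
  rw [inter_comm]
  exact E.pair_law hkl ρ ρ' (measurableSet_seed s k ρ τ) (measurableSet_seed s l ρ' τ)

theorem report_lintegral (E : Environment I Ω S) (s : Profile I S) (k : I) (τ : S)
    {h : Simplex S → ENNReal} (hh : Measurable h) :
    ∫⁻ x in {x | (E.report (s.strategy k) k x).1 = τ}, h (E.W x) ∂E.P =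
      ∫⁻ x, reportProb s k τ (E.W x) * h (E.W x) ∂E.P := by
  have hmeas : (E.P.restrict {x | (E.report (s.strategy k) k x).1 = τ}).map E.W =
      (E.P.withDensity fun x => reportProb s k τ (E.W x)).map E.W := by
    ext B hB
    rw [Measure.map_apply E.measurable_W hB, Measure.map_apply E.measurable_W hB,
      Measure.restrict_apply (E.measurable_W hB), withDensity_apply _ (E.measurable_W hB),
      E.report_law s k τ hB]
  rw [← lintegral_map hh E.measurable_W, hmeas, lintegral_map hh E.measurable_W,
    lintegral_withDensity_eq_lintegral_mul (f := fun x => reportProb s k τ (E.W x)) _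
      ((measurable_reportProb s k τ).comp E.measurable_W) (g := fun x => h (E.W x))
      (hh.comp E.measurable_W)]
  rfl

/-- Pairwise orthogonal vectors: all but countably many are orthogonal to a given vector. -/
theorem countable_inner_ne_zero {H J : Type*} [NormedAddCommGroup H] [InnerProductSpace ℝ H]
    (v : J → H) (hv : ∀ k l, k ≠ l → inner ℝ (v k) (v l) = 0) (y : H) :
    {k | inner ℝ (v k) y ≠ 0}.Countable := by
  let T : Set J := {k | v k ≠ 0}
  let e : T → H := fun k => (‖v k‖⁻¹ : ℝ) • v k
  have he : Orthonormal ℝ e := by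
    refine ⟨fun k => ?_, fun k l hkl => ?_⟩
    · have : ‖v k‖ ≠ 0 := norm_ne_zero_iff.2 k.2
      simp [e, norm_smul, this]
    · have : inner ℝ (v k) (v l) = 0 := hv _ _ fun h => hkl (Subtype.ext h)
      simp [e, inner_smul_left, inner_smul_right, this]
  have hc := (he.inner_products_summable y).countable_support
  refine (hc.image Subtype.val).mono fun k hk => ?_
  have hk0 : v k ≠ 0 := fun h => hk (by simp [h])
  refine ⟨⟨k, hk0⟩, ?_, rfl⟩
  have : ‖v k‖ ≠ 0 := norm_ne_zero_iff.2 hk0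
  simpa [e, inner_smul_left, this] using hk

/-- The deviation of the report indicator of agent `k` from its mean given the state. -/
noncomputable def dev (E : Environment I Ω S) (s : Profile I S) (τ : S) (k : I) (x : Ω) : ℝ :=
  {x | (E.report (s.strategy k) k x).1 = τ}.indicator 1 x - (reportProb s k τ (E.W x)).toReal

theorem measurable_prob (E : Environment I Ω S) (s : Profile I S) (τ : S) (k : I) :
    Measurable fun x => (reportProb s k τ (E.W x)).toReal :=
  ((measurable_reportProb s k τ).comp E.measurable_W).ennreal_toReal

theorem measurable_dev (E : Environment I Ω S) (s : Profile I S) (τ : S) (k : I) :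
    Measurable (E.dev s τ k) :=
  (measurable_one.indicator (E.measurableSet_report s k τ)).sub (E.measurable_prob s τ k)

theorem prob_mem (s : Profile I S) (τ : S) (k : I) (w : Simplex S) :
    0 ≤ (reportProb s k τ w).toReal ∧ (reportProb s k τ w).toReal ≤ 1 :=
  ⟨ENNReal.toReal_nonneg, ENNReal.toReal_le_of_le_ofReal zero_le_one
    (by simpa using reportProb_le_one s k τ w)⟩

theorem memLp_of_bound (E : Environment I Ω S) {f : Ω → ℝ} (hf : Measurable f)
    (hb : ∀ x, |f x| ≤ 1) (p : ENNReal) : MemLp f p E.P :=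
  MemLp.of_bound hf.aestronglyMeasurable 1 (ae_of_all _ hb)

theorem abs_ind_le (T : Set Ω) (x : Ω) : |T.indicator (1 : Ω → ℝ) x| ≤ 1 := by
  by_cases h : x ∈ T <;> simp [h]

theorem abs_dev_le (E : Environment I Ω S) (s : Profile I S) (τ : S) (k : I) (x : Ω) :
    |E.dev s τ k x| ≤ 1 := by
  have h := prob_mem s τ k (E.W x)
  unfold dev
  rw [abs_le]
  by_cases hx : x ∈ {x | (E.report (s.strategy k) k x).1 = τ}
  · rw [indicator_of_mem hx]
    constructor <;> simp only [Pi.one_apply] <;> linarith [h.1, h.2]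
  · rw [indicator_of_notMem hx]
    constructor <;> linarith [h.1, h.2]

theorem integral_ind_prob (E : Environment I Ω S) (s : Profile I S) (τ : S) (k l : I) :
    ∫ x, {x | (E.report (s.strategy k) k x).1 = τ}.indicator (1 : Ω → ℝ) x *
        (reportProb s l τ (E.W x)).toReal ∂E.P =
      ∫ x, (reportProb s k τ (E.W x)).toReal * (reportProb s l τ (E.W x)).toReal ∂E.P := by
  have h1 : ∀ x, {x | (E.report (s.strategy k) k x).1 = τ}.indicator (1 : Ω → ℝ) x *
      (reportProb s l τ (E.W x)).toReal = {x | (E.report (s.strategy k) k x).1 = τ}.indicator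
        (fun x => (reportProb s l τ (E.W x)).toReal) x := fun x => by
    by_cases h : x ∈ {x | (E.report (s.strategy k) k x).1 = τ}
    · rw [indicator_of_mem h, indicator_of_mem h]; simp
    · rw [indicator_of_notMem h, indicator_of_notMem h]; simp
  simp only [h1, ← ENNReal.toReal_mul]
  rw [integral_indicator (E.measurableSet_report s k τ), integral_toReal, integral_toReal,
    E.report_lintegral s k τ (measurable_reportProb s l τ)]
  · exact (((measurable_reportProb s k τ).comp E.measurable_W).mul
      ((measurable_reportProb s l τ).comp E.measurable_W)).aemeasurable
  · exact ae_of_all _ fun x => (mul_le_one' (reportProb_le_one s k τ _)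
      (reportProb_le_one s l τ _)).trans_lt ENNReal.one_lt_top
  · exact ((measurable_reportProb s l τ).comp E.measurable_W).aemeasurable
  · exact ae_of_all _ fun x => (reportProb_le_one s l τ _).trans_lt ENNReal.one_lt_top

theorem integral_dev_mul (E : Environment I Ω S) (s : Profile I S) (τ : S) {k l : I}
    (hkl : k ≠ l) : ∫ x, E.dev s τ k x * E.dev s τ l x ∂E.P = 0 := by
  set f : I → Ω → ℝ := fun k x =>
    {x | (E.report (s.strategy k) k x).1 = τ}.indicator (1 : Ω → ℝ) x with hf
  set g : I → Ω → ℝ := fun k x => (reportProb s k τ (E.W x)).toReal with hg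
  have hfm : ∀ k, Measurable (f k) := fun k =>
    measurable_one.indicator (E.measurableSet_report s k τ)
  have hgm : ∀ k, Measurable (g k) := fun k => E.measurable_prob s τ k
  have hfb : ∀ k x, |f k x| ≤ 1 := fun k x => abs_ind_le _ _
  have hgb : ∀ k x, |g k x| ≤ 1 := fun k x => by
    have h := prob_mem s τ k (E.W x)
    rw [abs_le]; constructor <;> linarith [h.1, h.2]
  have hint : ∀ a b : Ω → ℝ, Measurable a → Measurable b → (∀ x, |a x| ≤ 1) →
      (∀ x, |b x| ≤ 1) → Integrable (fun x => a x * b x) E.P := fun a b ha hb ha' hb' =>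
    memLp_one_iff_integrable.1 (E.memLp_of_bound (ha.mul hb) (fun x => by
      rw [Pi.mul_apply, abs_mul]; exact mul_le_one₀ (ha' x) (abs_nonneg _) (hb' x)) 1)
  have hff : ∫ x, f k x * f l x ∂E.P = ∫ x, g k x * g l x ∂E.P := by
    have h1 : ∀ x, f k x * f l x = ({x | (E.report (s.strategy k) k x).1 = τ} ∩
        {x | (E.report (s.strategy l) l x).1 = τ}).indicator (1 : Ω → ℝ) x := fun x => by
      simp only [hf, inter_indicator_one, Pi.mul_apply]
    simp only [h1, hg, ← ENNReal.toReal_mul]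
    rw [integral_indicator_one ((E.measurableSet_report s k τ).inter
      (E.measurableSet_report s l τ)), measureReal_def, E.report_pair_law s hkl τ, integral_toReal]
    · exact (((measurable_reportProb s k τ).comp E.measurable_W).mul
        ((measurable_reportProb s l τ).comp E.measurable_W)).aemeasurable
    · exact ae_of_all _ fun x => (mul_le_one' (reportProb_le_one s k τ _)
        (reportProb_le_one s l τ _)).trans_lt ENNReal.one_lt_top
  have hfg : ∫ x, f k x * g l x ∂E.P = ∫ x, g k x * g l x ∂E.P := E.integral_ind_prob s τ k l
  have hgf : ∫ x, f l x * g k x ∂E.P = ∫ x, g k x * g l x ∂E.P := by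
    rw [E.integral_ind_prob s τ l k]
    simp only [hg, mul_comm]
  have hexp : ∀ x, E.dev s τ k x * E.dev s τ l x =
      f k x * f l x - f k x * g l x - f l x * g k x + g k x * g l x := fun x => by
    simp only [dev, hf, hg]; ring
  simp only [hexp]
  have i1 := hint _ _ (hfm k) (hfm l) (hfb k) (hfb l)
  have i2 := hint _ _ (hfm k) (hgm l) (hfb k) (hgb l)
  have i3 := hint _ _ (hfm l) (hgm k) (hfb l) (hgb k)
  have i4 := hint _ _ (hgm k) (hgm l) (hgb k) (hgb l)
  have j2 : Integrable (fun x => f k x * f l x - f k x * g l x) E.P := i1.sub i2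
  have j3 : Integrable (fun x => f k x * f l x - f k x * g l x - f l x * g k x) E.P := j2.sub i3
  rw [integral_add j3 i4, integral_sub j2 i3, integral_sub i1 i2, hff, hfg, hgf]
  ring

theorem inner_toLp (E : Environment I Ω S) {f g : Ω → ℝ} (hf : MemLp f 2 E.P)
    (hg : MemLp g 2 E.P) : inner ℝ (hf.toLp f) (hg.toLp g) = ∫ x, f x * g x ∂E.P := by
  rw [L2.inner_def]
  refine integral_congr_ae ?_
  filter_upwards [hf.coeFn_toLp, hg.coeFn_toLp] with x h1 h2
  simp [h1, h2, mul_comm]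

/-- Exact law of large numbers on an event: for almost every agent, the probability of the event
that `A` occurs and she reports `τ` can be computed from the state. -/
theorem ae_report_event (E : Environment I Ω S) (s : Profile I S) (τ : S) {A : Set Ω}
    (hA : MeasurableSet A) :
    ∀ᵐ k ∂E.pop, E.P (A ∩ {x | (E.report (s.strategy k) k x).1 = τ}) =
      ∫⁻ x in A, reportProb s k τ (E.W x) ∂E.P := by
  have hd : ∀ k, MemLp (E.dev s τ k) 2 E.P := fun k =>
    E.memLp_of_bound (E.measurable_dev s τ k) (E.abs_dev_le s τ k) 2
  have h1 : MemLp (A.indicator (1 : Ω → ℝ)) 2 E.P :=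
    E.memLp_of_bound (measurable_one.indicator hA) (abs_ind_le A) 2
  have hc := countable_inner_ne_zero (fun k => (hd k).toLp _)
    (fun k l hkl => by rw [E.inner_toLp, E.integral_dev_mul s τ hkl]) (h1.toLp _)
  have h0 : E.pop {k | inner ℝ ((hd k).toLp _) (h1.toLp _) ≠ 0} = 0 := hc.measure_zero _
  filter_upwards [measure_eq_zero_iff_ae_notMem.1 h0] with k hk
  have hk' : inner ℝ ((hd k).toLp _) (h1.toLp _) = 0 := by simpa using hk
  rw [E.inner_toLp] at hk'
  have hR := E.measurableSet_report s k τ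
  have e1 : ∀ x, E.dev s τ k x * A.indicator (1 : Ω → ℝ) x =
      (A ∩ {x | (E.report (s.strategy k) k x).1 = τ}).indicator (1 : Ω → ℝ) x -
        A.indicator (fun x => (reportProb s k τ (E.W x)).toReal) x := fun x => by
    simp only [dev, inter_indicator_one, Pi.mul_apply]
    by_cases hx : x ∈ A
    · rw [indicator_of_mem hx, indicator_of_mem hx]; simp
    · rw [indicator_of_notMem hx, indicator_of_notMem hx]; simp
  have hgi : Integrable (fun x => (reportProb s k τ (E.W x)).toReal) E.P :=
    memLp_one_iff_integrable.1 (E.memLp_of_bound (E.measurable_prob s τ k) (fun x => by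
      have h := prob_mem s τ k (E.W x)
      rw [abs_le]; constructor <;> linarith [h.1, h.2]) 1)
  simp only [e1] at hk'
  have hfi : Integrable ((A ∩ {x | (E.report (s.strategy k) k x).1 = τ}).indicator
      (1 : Ω → ℝ)) E.P := (integrable_const (1 : ℝ)).indicator (hA.inter hR)
  rw [integral_sub hfi (hgi.indicator hA),
    integral_indicator_one (hA.inter hR), integral_indicator hA, integral_toReal, sub_eq_zero,
    measureReal_def, ENNReal.toReal_eq_toReal_iff' (measure_ne_top _ _)] at hk'
  · exact hk'
  · refine ((lintegral_mono fun x => reportProb_le_one s k τ (E.W x)).trans_lt ?_).ne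
    simp
  · exact ((measurable_reportProb s k τ).comp E.measurable_W).aemeasurable
  · exact ae_of_all _ fun x => (reportProb_le_one s k τ _).trans_lt ENNReal.one_lt_top

/-- The average probability that an agent with signal `ρ` reports `τ`. -/
noncomputable def avgProb (E : Environment I Ω S) (s : Profile I S) (ρ τ : S) : ENNReal :=
  ∫⁻ k, volume {u | (s.toFun k ρ u).1 = τ} ∂E.pop

theorem measurable_seedProb (s : Profile I S) (ρ τ : S) :
    Measurable fun k => volume {u | (s.toFun k ρ u).1 = τ} :=
  measurable_measure_prodMk_left
    ((measurable_fst.comp (s.measurable_toFun ρ)) (measurableSet_singleton τ))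

theorem avgProb_le_one (E : Environment I Ω S) (s : Profile I S) (ρ τ : S) :
    E.avgProb s ρ τ ≤ 1 :=
  (lintegral_mono fun _ => prob_le_one).trans (by simp)

theorem sum_avgProb (E : Environment I Ω S) (s : Profile I S) (ρ : S) :
    ∑ τ, E.avgProb s ρ τ = 1 := by
  simp only [avgProb]
  rw [← lintegral_finsetSum _ fun τ _ => measurable_seedProb s ρ τ]
  have : ∀ k, ∑ τ : S, volume {u | (s.toFun k ρ u).1 = τ} = 1 := fun k => by
    rw [← tsum_fintype (L := SummationFilter.unconditional _), ← measure_iUnion]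
    · have : (⋃ τ : S, {u | (s.toFun k ρ u).1 = τ}) = univ := by ext u; simp
      rw [this, measure_univ]
    · intro τ τ' h
      exact Set.disjoint_left.2 fun u hu hu' => h (hu.symm.trans hu')
    · exact fun τ => measurableSet_seed s k ρ τ
  simp [this]

/-- Every profile has a distribution of reported signals. -/
theorem exists_isReportDistribution (E : Environment I Ω S) (s : Profile I S) :
    ∃ V, E.IsReportDistribution s V := by
  have hle : ∀ (w : Simplex S) (τ : S), ∑ ρ, ENNReal.ofReal (w.1 ρ) * E.avgProb s ρ τ ≤ 1 :=
    fun w τ => by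
      rw [← sum_coord w]
      exact Finset.sum_le_sum fun ρ _ => mul_le_of_le_one_right' (E.avgProb_le_one s ρ τ)
  have htop : ∀ (w : Simplex S) (τ : S), ∑ ρ, ENNReal.ofReal (w.1 ρ) * E.avgProb s ρ τ ≠ ⊤ :=
    fun w τ => ((hle w τ).trans_lt ENNReal.one_lt_top).ne
  refine ⟨fun x => ⟨fun τ => (∑ ρ, ENNReal.ofReal ((E.W x).1 ρ) * E.avgProb s ρ τ).toReal,
    fun _ => ENNReal.toReal_nonneg, ?_⟩, ?_, ?_⟩
  · rw [← ENNReal.toReal_sum fun τ _ => htop _ τ, Finset.sum_comm]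
    simp only [← Finset.mul_sum, E.sum_avgProb s, mul_one, sum_coord, ENNReal.toReal_one]
  · refine Measurable.subtype_mk (measurable_pi_lambda _ fun τ => ?_)
    exact (Finset.measurable_sum _ fun ρ _ =>
      ((measurable_coord ρ).comp E.measurable_W).mul_const _).ennreal_toReal
  · intro τ A hA
    have hm : ∀ ρ : S, Measurable fun x => ENNReal.ofReal ((E.W x).1 ρ) :=
      fun ρ => (measurable_coord ρ).comp E.measurable_W
    simp only [ENNReal.ofReal_toReal (htop _ _)]
    rw [lintegral_finsetSum _ fun ρ _ => (hm ρ).mul_const _,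
      lintegral_congr_ae (E.ae_report_event s τ hA)]
    have h2 : ∀ k, ∫⁻ x in A, reportProb s k τ (E.W x) ∂E.P =
        ∑ ρ, (∫⁻ x in A, ENNReal.ofReal ((E.W x).1 ρ) ∂E.P) *
          volume {u | (s.toFun k ρ u).1 = τ} := fun k => by
      simp only [reportProb]
      rw [lintegral_finsetSum _ fun ρ _ => (hm ρ).mul_const _]
      exact Finset.sum_congr rfl fun ρ _ => lintegral_mul_const _ (hm ρ)
    simp only [h2]
    rw [lintegral_finsetSum _ fun ρ _ => (measurable_seedProb s ρ τ).const_mul _]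
    refine Finset.sum_congr rfl fun ρ _ => ?_
    rw [lintegral_mul_const _ (hm ρ), lintegral_const_mul _ (measurable_seedProb s ρ τ)]
    rfl

/-- `Ŵ`, the distribution over the agents' reported signals under the profile `s`; it is unique up
to null events. -/
noncomputable def reportDist (E : Environment I Ω S) (s : Profile I S) : Ω → Simplex S :=
  (E.exists_isReportDistribution s).choose

/-! ### Truth-telling -/

/-- The posterior expectation of agent `i` with signal `σ` for the fraction of the agents who receive
the signal `τ`. -/
noncomputable def posterior (E : Environment I Ω S) (i : I) (σ τ : S) : ℝ :=
  ∫ k, (E.P[|{x | E.Ψ i x = σ}]).real {x | E.Ψ k x = τ} ∂E.pop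

theorem posterior_eq (E : Environment I Ω S) (i : I) (σ τ : S) :
    E.posterior i σ τ = ((∫⁻ x, ENNReal.ofReal ((E.W x).1 σ) ∂E.P)⁻¹ *
      ∫⁻ x, ENNReal.ofReal ((E.W x).1 σ) * ENNReal.ofReal ((E.W x).1 τ) ∂E.P).toReal := by
  have h0 : E.pop {i} = 0 := measure_singleton i
  have h1 : E.P {x | E.Ψ i x = σ} = ∫⁻ x, ENNReal.ofReal ((E.W x).1 σ) ∂E.P := by
    simpa using E.single_law i σ MeasurableSet.univ MeasurableSet.univ
  have : ∀ᵐ k ∂E.pop, (E.P[|{x | E.Ψ i x = σ}]).real {x | E.Ψ k x = τ} =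
      ((∫⁻ x, ENNReal.ofReal ((E.W x).1 σ) ∂E.P)⁻¹ *
      ∫⁻ x, ENNReal.ofReal ((E.W x).1 σ) * ENNReal.ofReal ((E.W x).1 τ) ∂E.P).toReal := by
    filter_upwards [measure_eq_zero_iff_ae_notMem.1 h0] with k hk
    have hik : i ≠ k := fun h => hk (by simp [h])
    have h2 := E.pair_law hik σ τ MeasurableSet.univ MeasurableSet.univ
    simp only [mem_univ, and_true, measure_univ, mul_one] at h2
    have hms : MeasurableSet {x | E.Ψ i x = σ} := E.measurable_Ψ i (measurableSet_singleton σ)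
    rw [measureReal_def, cond_apply hms, h2, h1]
  rw [posterior, integral_congr_ae this]
  simp

open Classical in
/-- `q_σ`, the truthful prediction of agent `i` with signal `σ`. For a signal of probability zero,
where there is no posterior, it is the point mass at `σ`. -/
noncomputable def truePrediction (E : Environment I Ω S) (i : I) (σ : S) : Simplex S :=
  if h : E.posterior i σ ∈ stdSimplex ℝ S then ⟨E.posterior i σ, h⟩
  else ⟨Pi.single σ 1, single_mem_stdSimplex ℝ σ⟩

theorem truePrediction_eq (E : Environment I Ω S) (i j : I) (σ : S) :
    E.truePrediction i σ = E.truePrediction j σ := by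
  have h : E.posterior i σ = E.posterior j σ := by
    ext τ
    rw [posterior_eq, posterior_eq]
  unfold truePrediction
  rw [h]

/-- The profile in which every agent tells the truth: she reports her signal and her posterior
expectation. -/
noncomputable def truth (E : Environment I Ω S) : Profile I S where
  toFun i σ _ := (σ, E.truePrediction i σ)
  measurable_toFun σ := by
    refine measurable_const.prodMk (measurable_const' fun p p' => ?_)
    exact E.truePrediction_eq p.1 p'.1 σ

/-! ### Expected scores and equilibria -/

/-- The expected prediction score of agent `i` in BTS when she plays `t` and the other agents play
`s`; the reference agent `j` is uniformly random. A single agent does not change the distribution of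
reports, and the event `j = i` has probability zero. -/
noncomputable def predictionScore (E : Environment I Ω S) (s : Profile I S) (i : I)
    (t : Strategy S) : EReal :=
  emean E.pop fun j => emean E.P fun x =>
    scorePre (E.reportDist s x) (E.report t i x) (E.report (s.strategy j) j x)

/-- The expected information score of agent `i` in BTS when she plays `t` and the other agents play
`s`. -/
noncomputable def informationScore (E : Environment I Ω S) (s : Profile I S) (i : I)
    (t : Strategy S) : EReal :=
  emean E.pop fun j => emean E.P fun x =>
    scoreIm (E.reportDist s x) (E.report t i x) (E.report (s.strategy j) j x)

/-- The expected payment of agent `i` in BTS(`α`) when she plays `t` and the other agents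
play `s`. -/
noncomputable def payment (E : Environment I Ω S) (α : ℝ) (s : Profile I S) (i : I)
    (t : Strategy S) : EReal :=
  E.predictionScore s i t + (α : EReal) * E.informationScore s i t

/-- `s` is a Bayesian Nash equilibrium of BTS(`α`): the expected payments are finite, and no agent
can increase her expected payment by changing her strategy. -/
def IsEquilibrium (E : Environment I Ω S) (α : ℝ) (s : Profile I S) : Prop :=
  ∀ i, (E.payment α s i (s.strategy i) ≠ ⊥ ∧ E.payment α s i (s.strategy i) ≠ ⊤) ∧
    ∀ t, E.payment α s i t ≤ E.payment α s i (s.strategy i)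

/-- The expected average information score under `s`. -/
noncomputable def avgInformationScore (E : Environment I Ω S) (s : Profile I S) : EReal :=
  emean E.pop fun i => E.informationScore s i (s.strategy i)

/-- The expected average prediction score under `s`. -/
noncomputable def avgPredictionScore (E : Environment I Ω S) (s : Profile I S) : EReal :=
  emean E.pop fun i => E.predictionScore s i (s.strategy i)

/-- The agent welfare of `s`: the total expected payment to the agents, whose total weight is `1`. -/
noncomputable def welfare (E : Environment I Ω S) (α : ℝ) (s : Profile I S) : EReal :=
  emean E.pop fun i => E.payment α s i (s.strategy i)

/-- BTS(`α`) is focal: truth-telling is an equilibrium and maximizes the agent welfare among all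
equilibria. -/
def IsFocal (E : Environment I Ω S) (α : ℝ) : Prop :=
  E.IsEquilibrium α E.truth ∧
    ∀ s, E.IsEquilibrium α s → E.welfare α s ≤ E.welfare α E.truth

/-- `I(W; Ψ_i | Ψ_j)`. -/
noncomputable def infoTruth (E : Environment I Ω S) (i j : I) : ENNReal :=
  condMutualInfo (E.P.map fun x => (E.W x, E.Ψ i x, E.Ψ j x))

/-- `I(Ŵ; Ψ̂ | Ψ_j)` under the profile `s`, where `Ψ̂` is the reported signal of a uniformly random
agent `k`. -/
noncomputable def infoReport (E : Environment I Ω S) (s : Profile I S) (j : I) : ENNReal :=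
  condMutualInfo (E.pop.bind fun k =>
    E.P.map fun x => (E.reportDist s x, (E.report (s.strategy k) k x).1, E.Ψ j x))

end Existence

end Environment
end BTS

/-!
# Bayesian Truth Serum: scores as mutual information

All quantities are handled as extended nonnegative numbers, through `nlog x = -log x`: both scores
are differences of two such losses, and `emean_coe_sub` computes their expectations.

By the exact law of large numbers, the distribution of reports is a function `reportFreq` of the
state. For a profile `s` there are two entropies of the report of a random agent: `stateEntropy`,
given the state, and `peerEntropy`, given the private signal of another agent. Both are finite, and
their difference is the mutual information of the theorem (`mutualInfo_add_entropy`,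
`infoTruth_add_stateEntropy`, `infoReport_add_stateEntropy`).

The prediction of an agent affects only her prediction score, which is `stateEntropy` minus a
logarithmic loss (`predictionScore_eq`). The logarithmic scoring rule is strictly proper, so in an
equilibrium all predictions are posteriors (`IsEquilibrium.isCalibrated`). For such profiles every
prediction score is `stateEntropy - peerEntropy`, the average information score is
`peerEntropy - stateEntropy`, and the welfare is `(α - 1) * (peerEntropy - stateEntropy)`.

A single inequality, `lintegral_nlog_exchange`, then gives both comparisons with the truth. For two
signals `σ`, `ρ` and a random frequency `v`, it compares how well `v` and the true frequency of `ρ`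
are predicted by their posteriors given `σ`; it follows from `log x ≤ x - 1`. Summed over garblings
of the signals (`garbling_le`), it shows that misreports do not pay against truthful agents, and
that no profile has a larger difference of entropies than the truth.
-/

open scoped ENNReal

/-! ### Extended expectations -/

section emean

variable {X : Type*} [MeasurableSpace X] {μ : Measure X}

theorem emean_congr_ae {f g : X → EReal} (h : f =ᵐ[μ] g) : emean μ f = emean μ g := by
  unfold emean
  congr 2
  · exact lintegral_congr_ae (h.mono fun x hx => congrArg EReal.toENNReal hx)
  · exact lintegral_congr_ae (h.mono fun x hx => congrArg (fun y : EReal => (-y).toENNReal) hx)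

theorem emean_const [IsProbabilityMeasure μ] (c : EReal) : emean μ (fun _ => c) = c := by
  unfold emean
  rw [lintegral_const, lintegral_const, measure_univ, mul_one, mul_one]
  rcases le_total 0 c with h | h
  · rw [EReal.coe_toENNReal h, EReal.toENNReal_of_nonpos (by simpa using h)]
    simp
  · rw [EReal.toENNReal_of_nonpos h, EReal.coe_toENNReal (by simpa using h)]
    simp

theorem emean_eq_const [IsProbabilityMeasure μ] {f : X → EReal} {c : EReal}
    (h : ∀ᵐ x ∂μ, f x = c) : emean μ f = c := by
  rw [emean_congr_ae (g := fun _ => c) h, emean_const]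

theorem emean_eq_bot {f : X → EReal} {T : Set X} (hT : MeasurableSet T) (h0 : μ T ≠ 0)
    (h : ∀ᵐ x ∂μ, x ∈ T → f x = ⊥) : emean μ f = ⊥ := by
  have : ∫⁻ x, (-f x).toENNReal ∂μ = ⊤ := by
    refine top_unique ?_
    calc ⊤ = ∫⁻ _ in T, ⊤ ∂μ := by simp [h0]
      _ ≤ ∫⁻ x in T, (-f x).toENNReal ∂μ :=
          lintegral_mono_ae (((ae_restrict_iff' hT).2 h).mono fun x hx => by simp [hx])
      _ ≤ _ := setLIntegral_le_lintegral _ _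
  unfold emean
  rw [this]
  simp [EReal.sub_top]

/-- The expectation of a difference of two nonnegative extended random variables, one of which has
finite mean. -/
theorem emean_coe_sub {P N : X → ℝ≥0∞} (hP : AEMeasurable P μ) (hN : AEMeasurable N μ)
    (h : ∫⁻ x, P x ∂μ ≠ ⊤ ∨ ∫⁻ x, N x ∂μ ≠ ⊤) :
    emean μ (fun x => (P x : EReal) - (N x : EReal)) =
      ((∫⁻ x, P x ∂μ : ℝ≥0∞) : EReal) - ((∫⁻ x, N x ∂μ : ℝ≥0∞) : EReal) := by
  have h1 : ∀ x, ((P x : EReal) - (N x : EReal)).toENNReal = P x - N x := fun x => by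
    rw [EReal.toENNReal_sub (EReal.coe_ennreal_nonneg _)]; simp
  have hfin : ∀ᵐ x ∂μ, P x ≠ ⊤ ∨ N x ≠ ⊤ := by
    rcases h with h | h
    · exact (ae_lt_top' hP h).mono fun x hx => Or.inl hx.ne
    · exact (ae_lt_top' hN h).mono fun x hx => Or.inr hx.ne
  have h2 : ∀ᵐ x ∂μ, (-((P x : EReal) - (N x : EReal))).toENNReal = N x - P x := by
    filter_upwards [hfin] with x hx
    rw [EReal.neg_sub (Or.inl (by simp)) (by simpa using hx), add_comm, ← sub_eq_add_neg,
      EReal.toENNReal_sub (EReal.coe_ennreal_nonneg _)]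
    simp
  unfold emean
  rw [lintegral_congr_ae h2, lintegral_congr fun x => h1 x]
  have hm : AEMeasurable (fun x => min (P x) (N x)) μ := hP.min hN
  have e1 : ∫⁻ x, (P x - N x) ∂μ + ∫⁻ x, min (P x) (N x) ∂μ = ∫⁻ x, P x ∂μ := by
    rw [← lintegral_add_right' _ hm]
    refine lintegral_congr fun x => ?_
    rcases le_total (P x) (N x) with h | h
    · simp [h, tsub_eq_zero_of_le h]
    · simp [h, tsub_add_cancel_of_le h]
  have e2 : ∫⁻ x, (N x - P x) ∂μ + ∫⁻ x, min (P x) (N x) ∂μ = ∫⁻ x, N x ∂μ := by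
    rw [← lintegral_add_right' _ hm]
    refine lintegral_congr fun x => ?_
    rcases le_total (P x) (N x) with h | h
    · simp [h, tsub_add_cancel_of_le h]
    · simp [h, tsub_eq_zero_of_le h]
  have hmt : ∫⁻ x, min (P x) (N x) ∂μ ≠ ⊤ := by
    rcases h with h | h
    · exact ne_top_of_le_ne_top h (lintegral_mono fun x => min_le_left _ _)
    · exact ne_top_of_le_ne_top h (lintegral_mono fun x => min_le_right _ _)
  rw [← e1, ← e2]
  lift ∫⁻ x, min (P x) (N x) ∂μ to NNReal using hmt with m
  generalize ∫⁻ x, (P x - N x) ∂μ = a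
  generalize ∫⁻ x, (N x - P x) ∂μ = b
  induction a using ENNReal.recTopCoe with
  | top =>
    induction b using ENNReal.recTopCoe with
    | top => simp
    | coe b =>
      rw [top_add, ← ENNReal.coe_add]
      rfl
  | coe a =>
    induction b using ENNReal.recTopCoe with
    | top =>
      rw [top_add, ← ENNReal.coe_add]
      rfl
    | coe b =>
      rw [← ENNReal.coe_add, ← ENNReal.coe_add]
      simp only [EReal.coe_nnreal_eq_coe_real, ← EReal.coe_sub, NNReal.coe_add]
      congr 1
      ring

end emean

namespace BTS

/-! ### The negative logarithm on the unit interval -/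

/-- `-log x` as an extended nonnegative number; it is `⊤` at `0`, and truncated to `0` for `x ≥ 1`. -/
noncomputable def nlog (x : ℝ≥0∞) : ℝ≥0∞ := (-ENNReal.log x).toENNReal

@[simp] theorem nlog_zero : nlog 0 = ⊤ := by simp [nlog]

@[fun_prop]
theorem measurable_nlog : Measurable nlog :=
  ENNReal.measurable_log.neg.ereal_toENNReal

theorem coe_nlog {x : ℝ≥0∞} (hx : x ≤ 1) : (nlog x : EReal) = -ENNReal.log x :=
  EReal.coe_toENNReal (by
    have := ENNReal.log_le_zero_iff.2 hx
    rwa [EReal.neg_nonneg])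

theorem nlog_ne_top {x : ℝ≥0∞} (hx : x ≠ 0) : nlog x ≠ ⊤ := by
  simp [nlog, hx]

theorem nlog_mul {x y : ℝ≥0∞} (hx : x ≤ 1) (hy : y ≤ 1) : nlog (x * y) = nlog x + nlog y := by
  rw [← EReal.coe_ennreal_eq_coe_ennreal_iff, EReal.coe_ennreal_add, coe_nlog hx, coe_nlog hy,
    coe_nlog (mul_le_one' hx hy), ENNReal.log_mul_add, EReal.neg_add, sub_eq_add_neg]
  · exact Or.inr (by simpa using (hy.trans_lt ENNReal.one_lt_top).ne)
  · exact Or.inl (by simpa using (hx.trans_lt ENNReal.one_lt_top).ne)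

theorem nlog_ofReal {x : ℝ} (hx : 0 < x) : nlog (ENNReal.ofReal x) = ENNReal.ofReal (-Real.log x) := by
  rw [nlog, ENNReal.log_ofReal_of_pos hx, ← EReal.coe_neg, EReal.real_coe_toENNReal]

theorem elog_eq_neg_nlog {x : ℝ} (hx : x ≤ 1) : elog x = -(nlog (ENNReal.ofReal x) : EReal) := by
  rw [coe_nlog (by simpa using hx), neg_neg, elog]

/-- The integrand of the Kullback-Leibler divergence of `v` from `q`, in terms of `nlog`. -/
theorem klFun_add_nlog {v q : ℝ≥0∞} (hv : v ≤ 1) (hq : q ≤ 1) (hq0 : q ≠ 0) :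
    q * ENNReal.ofReal (InformationTheory.klFun (v / q).toReal) + (v * nlog v + v) =
      v * nlog q + q := by
  lift v to NNReal using (hv.trans_lt ENNReal.one_lt_top).ne
  lift q to NNReal using (hq.trans_lt ENNReal.one_lt_top).ne
  norm_cast at hv hq hq0
  have hq' : (0 : ℝ) < q := by positivity
  rcases eq_or_ne v 0 with rfl | hv0
  · simp [InformationTheory.klFun_zero]
  have hv' : (0 : ℝ) < v := by positivity
  have e : ∀ x : NNReal, (x : ℝ≥0∞) = ENNReal.ofReal x := fun x => by simp
  have hlv : 0 ≤ -Real.log v := by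
    have := Real.log_nonpos hv'.le hv; linarith
  have hlq : 0 ≤ -Real.log q := by
    have := Real.log_nonpos hq'.le hq; linarith
  have hk := InformationTheory.klFun_nonneg (div_pos hv' hq').le
  rw [e v, e q, nlog_ofReal hv', nlog_ofReal hq', ← ENNReal.ofReal_div_of_pos hq',
    ENNReal.toReal_ofReal (by positivity), ← ENNReal.ofReal_mul (by positivity),
    ← ENNReal.ofReal_mul (by positivity), ← ENNReal.ofReal_mul (by positivity),
    ← ENNReal.ofReal_add (by positivity) (by positivity),
    ← ENNReal.ofReal_add (by positivity) (by positivity),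
    ← ENNReal.ofReal_add (by positivity) (by positivity), InformationTheory.klFun_apply,
    Real.log_div hv'.ne' hq'.ne']
  congr 1
  field_simp
  ring

theorem gibbs_le {v q : ℝ≥0∞} (hv : v ≤ 1) (hq : q ≤ 1) :
    v * nlog v + v ≤ v * nlog q + q := by
  rcases eq_or_ne q 0 with rfl | hq0
  · rcases eq_or_ne v 0 with rfl | hv0
    · simp
    · simp [ENNReal.mul_top hv0]
  · rw [← klFun_add_nlog hv hq hq0]
    exact le_add_self

theorem mul_nlog_le_one {v : ℝ≥0∞} (hv : v ≤ 1) : v * nlog v ≤ 1 := by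
  have h := gibbs_le hv le_rfl
  have h1 : nlog 1 = 0 := by simp [nlog]
  rw [h1, mul_zero, zero_add] at h
  exact le_self_add.trans h

theorem eq_of_gibbs_eq {v q : ℝ≥0∞} (hv : v ≤ 1) (hq : q ≤ 1)
    (h : v * nlog q + q ≤ v * nlog v + v) : q = v := by
  have ht : v * nlog v + v ≠ ⊤ :=
    ENNReal.add_ne_top.2 ⟨ne_top_of_le_ne_top ENNReal.one_ne_top (mul_nlog_le_one hv),
      ne_top_of_le_ne_top ENNReal.one_ne_top hv⟩
  rcases eq_or_ne q 0 with rfl | hq0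
  · by_contra hv0
    rw [nlog_zero, ENNReal.mul_top (Ne.symm hv0), top_add] at h
    exact ht (top_unique h)
  · have h0 : q * ENNReal.ofReal (InformationTheory.klFun (v / q).toReal) = 0 := by
      rw [← klFun_add_nlog hv hq hq0] at h
      by_contra hne
      exact absurd h (not_le.2 (by
        rw [add_comm (q * _)]; exact ENNReal.lt_add_right ht hne))
    have hk := (mul_eq_zero.1 h0).resolve_left hq0
    have hk' := le_antisymm (ENNReal.ofReal_eq_zero.1 hk)
      (InformationTheory.klFun_nonneg ENNReal.toReal_nonneg)
    rw [InformationTheory.klFun_eq_zero_iff ENNReal.toReal_nonneg, ENNReal.toReal_eq_one_iff,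
      ENNReal.div_eq_one_iff hq0 (hq.trans_lt ENNReal.one_lt_top).ne] at hk'
    exact hk'.symm

/-- The pointwise form of the inequality behind both the optimality of truthful signals and the
loss of information through garbled reports: the error terms `w` and `v * q / r` have the same mean
when `q` and `r` are the means of `w` and `v`. -/
theorem nlog_exchange {w v q r : ℝ≥0∞} (hw : w ≤ 1) (hv : v ≤ 1) (hq : q ≤ 1) (hr : r ≤ 1)
    (hr0 : r ≠ 0) :
    w * (nlog r + nlog w) + w ≤ w * (nlog q + nlog v) + v * (q * r⁻¹) := by
  have h := gibbs_le (mul_le_one' hr hw) (mul_le_one' hq hv)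
  rw [nlog_mul hr hw, nlog_mul hq hv] at h
  have hrt : r ≠ ⊤ := (hr.trans_lt ENNReal.one_lt_top).ne
  have h2 := mul_le_mul_right h r⁻¹
  have e : ∀ y, r⁻¹ * (r * w * y) = w * y := fun y => by
    rw [← mul_assoc, ← mul_assoc, ENNReal.inv_mul_cancel hr0 hrt, one_mul]
  have e' : r⁻¹ * (r * w) = w := by simpa using e 1
  rw [mul_add r⁻¹, mul_add r⁻¹, e, e, e'] at h2
  convert h2 using 2
  ring

/-! ### The distribution of reported signals -/

/-- The weight of the signal `σ` in the distribution `w`, as an extended nonnegative number. -/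
noncomputable abbrev weight {S : Type*} [Fintype S] (w : Simplex S) (σ : S) : ℝ≥0∞ :=
  ENNReal.ofReal (w.1 σ)

/-- The profile in which every agent plays `t`. -/
def Profile.const {I S : Type*} [MeasurableSpace I] [Fintype S] [MeasurableSpace S]
    (t : Strategy S) : Profile I S where
  toFun _ := t.toFun
  measurable_toFun σ := (t.measurable_toFun σ).comp measurable_snd

theorem weight_le_one {S : Type*} [Fintype S] (w : Simplex S) (σ : S) : weight w σ ≤ 1 := by
  have h : w.1 σ ≤ 1 := by
    rw [← w.2.2]
    exact Finset.single_le_sum (fun i _ => w.2.1 i) (Finset.mem_univ σ)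
  simpa using h

namespace Environment

variable {I Ω S : Type*} [MeasurableSpace I] [MeasurableSpace Ω] [Fintype S] [MeasurableSpace S]
  [MeasurableSingletonClass S]

@[fun_prop]
theorem measurable_weight (E : Environment I Ω S) (σ : S) :
    Measurable fun x => weight (E.W x) σ :=
  (measurable_coord σ).comp E.measurable_W

/-- The fraction of the agents who report `τ` under the profile `s` when the state is `w`. -/
noncomputable def reportFreq (E : Environment I Ω S) (s : Profile I S) (w : Simplex S) (τ : S) :
    ℝ≥0∞ :=
  ∑ ρ, weight w ρ * E.avgProb s ρ τ

theorem measurable_reportFreq (E : Environment I Ω S) (s : Profile I S) (τ : S) :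
    Measurable fun w => E.reportFreq s w τ :=
  Finset.measurable_sum _ fun ρ _ => (measurable_coord ρ).mul_const _

@[fun_prop]
theorem measurable_reportFreq_W (E : Environment I Ω S) (s : Profile I S) (τ : S) :
    Measurable fun x => E.reportFreq s (E.W x) τ :=
  (E.measurable_reportFreq s τ).comp E.measurable_W

theorem sum_reportFreq (E : Environment I Ω S) (s : Profile I S) (w : Simplex S) :
    ∑ τ, E.reportFreq s w τ = 1 := by
  unfold reportFreq
  rw [Finset.sum_comm]
  simp only [← Finset.mul_sum, E.sum_avgProb s, mul_one, sum_coord]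

theorem reportFreq_le_one (E : Environment I Ω S) (s : Profile I S) (w : Simplex S) (τ : S) :
    E.reportFreq s w τ ≤ 1 := by
  rw [← E.sum_reportFreq s w]
  exact Finset.single_le_sum (f := fun τ => E.reportFreq s w τ) (fun _ _ => zero_le)
    (Finset.mem_univ τ)

@[fun_prop]
theorem measurable_reportProb_W (E : Environment I Ω S) (s : Profile I S) (j : I) (τ : S) :
    Measurable fun x => reportProb s j τ (E.W x) :=
  (measurable_reportProb s j τ).comp E.measurable_W

/-- The report probability is linear in the agent's strategy, which makes its integrals measurable in
the agent. -/
theorem lintegral_reportProb_mul (E : Environment I Ω S) (s : Profile I S) (j : I) (τ : S)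
    {f : Ω → ℝ≥0∞} (hf : Measurable f) :
    ∫⁻ x, reportProb s j τ (E.W x) * f x ∂E.P =
      ∑ ρ, (∫⁻ x, weight (E.W x) ρ * f x ∂E.P) * volume {u | (s.toFun j ρ u).1 = τ} := by
  simp only [reportProb, Finset.sum_mul]
  rw [lintegral_finsetSum _ fun ρ _ => by fun_prop]
  refine Finset.sum_congr rfl fun ρ _ => ?_
  rw [← lintegral_mul_const _ (by fun_prop)]
  exact lintegral_congr fun x => by ring

theorem measurable_lintegral_reportProb_mul (E : Environment I Ω S) (s : Profile I S) (τ : S)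
    {f : Ω → ℝ≥0∞} (hf : Measurable f) :
    Measurable fun j => ∫⁻ x, reportProb s j τ (E.W x) * f x ∂E.P := by
  simp only [E.lintegral_reportProb_mul s _ τ hf]
  exact Finset.measurable_sum _ fun ρ _ => (measurable_seedProb s ρ τ).const_mul _

theorem lintegral_lintegral_reportProb_mul (E : Environment I Ω S) (s : Profile I S) (τ : S)
    {f : Ω → ℝ≥0∞} (hf : Measurable f) :
    ∫⁻ j, ∫⁻ x, reportProb s j τ (E.W x) * f x ∂E.P ∂E.pop =
      ∫⁻ x, E.reportFreq s (E.W x) τ * f x ∂E.P := by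
  simp only [E.lintegral_reportProb_mul s _ τ hf, reportFreq, Finset.sum_mul]
  rw [lintegral_finsetSum _ fun ρ _ => (measurable_seedProb s ρ τ).const_mul _,
    lintegral_finsetSum _ fun ρ _ => by fun_prop]
  refine Finset.sum_congr rfl fun ρ _ => ?_
  rw [lintegral_const_mul _ (measurable_seedProb s ρ τ),
    ← lintegral_mul_const _ (by fun_prop)]
  exact lintegral_congr fun x => by rw [avgProb]; ring

/-- The defining averages of a distribution of reported signals, evaluated by the exact law of
large numbers. -/
theorem lintegral_report_event (E : Environment I Ω S) (s : Profile I S) (τ : S) {A : Set Ω}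
    (hA : MeasurableSet A) :
    ∫⁻ k, E.P (A ∩ {x | (E.report (s.strategy k) k x).1 = τ}) ∂E.pop =
      ∫⁻ x in A, E.reportFreq s (E.W x) τ ∂E.P := by
  rw [lintegral_congr_ae (E.ae_report_event s τ hA), ← lintegral_indicator hA]
  have h := E.lintegral_lintegral_reportProb_mul s τ (f := A.indicator 1)
    (measurable_one.indicator hA)
  have e : ∀ (g : Ω → ℝ≥0∞) x, g x * A.indicator 1 x = A.indicator g x := fun g x => by
    by_cases hx : x ∈ A <;> simp [hx]
  rw [← lintegral_congr fun x => e (fun x => E.reportFreq s (E.W x) τ) x, ← h]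
  refine lintegral_congr fun k => ?_
  rw [← lintegral_indicator hA]
  exact lintegral_congr fun x => (e (fun x => reportProb s k τ (E.W x)) x).symm

theorem weight_reportDist (E : Environment I Ω S) (s : Profile I S) :
    ∀ᵐ x ∂E.P, ∀ τ, weight (E.reportDist s x) τ = E.reportFreq s (E.W x) τ := by
  have hd := (E.exists_isReportDistribution s).choose_spec
  refine ae_all_iff.2 fun τ => ?_
  refine ae_eq_of_forall_setLIntegral_eq_of_sigmaFinite
    ((measurable_coord τ).comp hd.measurable) (E.measurable_reportFreq_W s τ) fun A hA _ => ?_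
  rw [← E.lintegral_report_event s τ hA]
  exact hd.average τ A hA

/-- The joint law of the state, the signal and seed of one agent, and the report of another. -/
theorem atom_report_law (E : Environment I Ω S) (s : Profile I S) {i j : I} (hij : i ≠ j)
    (σ τ : S) {A : Set unitInterval} (hA : MeasurableSet A) {B : Set (Simplex S)}
    (hB : MeasurableSet B) :
    E.P ((E.W ⁻¹' B ∩ {x | E.Ψ i x = σ ∧ E.U i x ∈ A}) ∩
        {x | (E.report (s.strategy j) j x).1 = τ}) =
      ∫⁻ x in E.W ⁻¹' B, weight (E.W x) σ * reportProb s j τ (E.W x) * volume A ∂E.P := by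
  classical
  rw [report_event_inter _ _ _ _ ((E.measurable_W hB).inter (E.measurableSet_atom i σ hA))]
  have hm : ∀ ρ : S, Measurable fun x => weight (E.W x) σ * volume A *
      (weight (E.W x) ρ * volume {u | (s.toFun j ρ u).1 = τ}) := fun ρ =>
    ((E.measurable_weight σ).mul_const _).mul ((E.measurable_weight ρ).mul_const _)
  have e : ∀ x, weight (E.W x) σ * reportProb s j τ (E.W x) * volume A =
      ∑ ρ, weight (E.W x) σ * volume A *
        (weight (E.W x) ρ * volume {u | (s.toFun j ρ u).1 = τ}) := fun x => by
    rw [reportProb, ← Finset.mul_sum]; ring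
  simp only [e]
  rw [lintegral_finsetSum _ fun ρ _ => hm ρ]
  refine Finset.sum_congr rfl fun ρ _ => ?_
  have h := E.cond_iid {i, j} (fun k => if k = i then σ else ρ)
    (fun k => if k = i then A else {u | (s.toFun j ρ u).1 = τ}) B
    (fun k => by split_ifs; exacts [hA, measurableSet_seed s j ρ τ]) hB
  simpa [hij, hij.symm, Finset.prod_pair, inter_assoc] using h

/-- `atom_report_law` as a statement about expectations. -/
theorem lintegral_report_pair (E : Environment I Ω S) (s : Profile I S) {i j : I} (hij : i ≠ j)
    {F : S → S → Simplex S → unitInterval → ℝ≥0∞}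
    (hF : ∀ τ σ, Measurable (Function.uncurry (F τ σ))) :
    ∫⁻ x, F (E.report (s.strategy j) j x).1 (E.Ψ i x) (E.W x) (E.U i x) ∂E.P =
      ∑ σ, ∑ τ, ∫⁻ x, weight (E.W x) σ * reportProb s j τ (E.W x) *
        (∫⁻ u, F τ σ (E.W x) u) ∂E.P := by
  set T : S × S → Set Ω := fun p =>
    {x | E.Ψ i x = p.1} ∩ {x | (E.report (s.strategy j) j x).1 = p.2} with hT
  have hTm : ∀ p, MeasurableSet (T p) := fun p =>
    (E.measurable_Ψ i (measurableSet_singleton p.1)).inter (E.measurableSet_report s j p.2)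
  have hTd : Pairwise (Function.onFun Disjoint T) := by
    intro p p' h
    refine Set.disjoint_left.2 fun x hx hx' => h ?_
    exact Prod.ext (hx.1.symm.trans hx'.1) (hx.2.symm.trans hx'.2)
  have hTu : ⋃ p, T p = univ := by
    ext x
    simp [hT]
  rw [← setLIntegral_univ, ← hTu, lintegral_iUnion hTm hTd, tsum_fintype, Fintype.sum_prod_type]
  refine Finset.sum_congr rfl fun σ _ => Finset.sum_congr rfl fun τ _ => ?_
  have hd : Measurable fun x => weight (E.W x) σ * reportProb s j τ (E.W x) := by fun_prop
  have hWU : Measurable fun x => (E.W x, E.U i x) := E.measurable_W.prodMk (E.measurable_U i)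
  have hle : ∀ x, weight (E.W x) σ * reportProb s j τ (E.W x) ≤ 1 := fun x =>
    mul_le_one' (weight_le_one _ _) (reportProb_le_one s j τ _)
  have : IsFiniteMeasure
      (E.P.withDensity fun x => weight (E.W x) σ * reportProb s j τ (E.W x)) := by
    refine isFiniteMeasure_withDensity
      (ne_top_of_le_ne_top ENNReal.one_ne_top ((lintegral_mono hle).trans ?_))
    simp
  have hlaw : (((E.P.withDensity fun x =>
      weight (E.W x) σ * reportProb s j τ (E.W x)).map E.W).prod volume) =
      (E.P.restrict (T (σ, τ))).map fun x => (E.W x, E.U i x) := by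
    refine Measure.prod_eq fun B A hB hA => ?_
    rw [Measure.map_apply hWU (hB.prod hA), Measure.restrict_apply (hWU (hB.prod hA)),
      Measure.map_apply E.measurable_W hB, withDensity_apply _ (E.measurable_W hB),
      ← lintegral_mul_const _ hd, ← E.atom_report_law s hij σ τ hA hB]
    congr 1
    ext x
    simp only [hT, mem_inter_iff, mem_preimage, mem_prod, mem_ofPred_eq]
    tauto
  calc ∫⁻ x in T (σ, τ), F (E.report (s.strategy j) j x).1 (E.Ψ i x) (E.W x) (E.U i x) ∂E.P
      = ∫⁻ x in T (σ, τ), Function.uncurry (F τ σ) (E.W x, E.U i x) ∂E.P :=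
        setLIntegral_congr_fun (hTm _) fun x hx => by
          obtain ⟨h1, h2⟩ := hx
          simp only [mem_ofPred_eq] at h1 h2
          rw [h1, h2]; rfl
    _ = ∫⁻ p, Function.uncurry (F τ σ) p ∂((E.P.restrict (T (σ, τ))).map
          fun x => (E.W x, E.U i x)) := (lintegral_map (hF τ σ) hWU).symm
    _ = ∫⁻ w, ∫⁻ u, F τ σ w u ∂volume ∂((E.P.withDensity fun x =>
          weight (E.W x) σ * reportProb s j τ (E.W x)).map E.W) := by
        rw [← hlaw, lintegral_prod _ (hF τ σ).aemeasurable]; rfl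
    _ = _ := by
        have hFm : Measurable fun w => ∫⁻ u, F τ σ w u := (hF τ σ).lintegral_prod_right'
        rw [lintegral_map hFm E.measurable_W,
          lintegral_withDensity_eq_lintegral_mul _ hd
            (g := fun x => ∫⁻ u, F τ σ (E.W x) u)
            (hFm.comp E.measurable_W)]
        rfl

end Environment

/-! ### Logarithmic scoring and the exchange inequality -/

/-- The logarithmic scoring rule is proper: the expected loss `-log p` is least when `p` is the
normalization of `m`. -/
theorem sum_mul_nlog_le {S : Type*} [Fintype S] {m p : S → ℝ≥0∞} (hm : ∑ τ, m τ ≠ ⊤)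
    (hp : ∑ τ, p τ = 1) :
    ∑ τ, m τ * nlog ((∑ τ, m τ)⁻¹ * m τ) ≤ ∑ τ, m τ * nlog (p τ) := by
  rcases eq_or_ne (∑ τ, m τ) 0 with h0 | h0
  · have : ∀ τ, m τ = 0 := fun τ => by simpa using (Finset.sum_eq_zero_iff.1 h0) τ
    simp [this]
  set M := ∑ τ, m τ with hM
  have hle : ∀ τ, M⁻¹ * m τ ≤ 1 := fun τ => by
    rw [← ENNReal.inv_mul_cancel h0 hm]
    gcongr
    exact Finset.single_le_sum (f := m) (fun _ _ => zero_le) (Finset.mem_univ τ)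
  have hp1 : ∀ τ, p τ ≤ 1 := fun τ => by
    rw [← hp]
    exact Finset.single_le_sum (f := p) (fun _ _ => zero_le) (Finset.mem_univ τ)
  have e : ∀ τ, M * (M⁻¹ * m τ) = m τ := fun τ => by
    rw [← mul_assoc, ENNReal.mul_inv_cancel h0 hm, one_mul]
  have h : ∀ τ, m τ * nlog (M⁻¹ * m τ) + m τ ≤ m τ * nlog (p τ) + M * p τ := fun τ => by
    have h := mul_le_mul_right (gibbs_le (hle τ) (hp1 τ)) M
    rwa [mul_add, mul_add, ← mul_assoc, ← mul_assoc M _ (nlog (p τ)), e] at h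
  have hs := Finset.sum_le_sum fun τ (_ : τ ∈ Finset.univ) => h τ
  rw [Finset.sum_add_distrib, Finset.sum_add_distrib, ← Finset.mul_sum, hp, mul_one, ← hM] at hs
  exact (ENNReal.add_le_add_iff_right hm).1 hs

/-- The logarithmic scoring rule is strictly proper. -/
theorem eq_of_sum_mul_nlog_le {S : Type*} [Fintype S] {m p : S → ℝ≥0∞} (hm : ∑ τ, m τ ≠ ⊤)
    (h0 : ∑ τ, m τ ≠ 0) (hp : ∑ τ, p τ = 1)
    (heq : ∑ τ, m τ * nlog (p τ) ≤ ∑ τ, m τ * nlog ((∑ τ, m τ)⁻¹ * m τ)) (τ : S) :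
    p τ = (∑ τ, m τ)⁻¹ * m τ := by
  set M := ∑ τ, m τ with hM
  have hle : ∀ τ, M⁻¹ * m τ ≤ 1 := fun τ => by
    rw [← ENNReal.inv_mul_cancel h0 hm]
    gcongr
    exact Finset.single_le_sum (f := m) (fun _ _ => zero_le) (Finset.mem_univ τ)
  have hp1 : ∀ τ, p τ ≤ 1 := fun τ => by
    rw [← hp]
    exact Finset.single_le_sum (f := p) (fun _ _ => zero_le) (Finset.mem_univ τ)
  have e : ∀ τ, M * (M⁻¹ * m τ) = m τ := fun τ => by
    rw [← mul_assoc, ENNReal.mul_inv_cancel h0 hm, one_mul]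
  have h : ∀ τ ∈ Finset.univ, M⁻¹ * m τ * nlog (M⁻¹ * m τ) + M⁻¹ * m τ ≤
      M⁻¹ * m τ * nlog (p τ) + p τ := fun τ _ => gibbs_le (hle τ) (hp1 τ)
  have hsum : ∑ τ, M⁻¹ * m τ = 1 := by
    rw [← Finset.mul_sum, ← hM, ENNReal.inv_mul_cancel h0 hm]
  have htot : ∑ τ, (M⁻¹ * m τ * nlog (p τ) + p τ) ≤
      ∑ τ, (M⁻¹ * m τ * nlog (M⁻¹ * m τ) + M⁻¹ * m τ) := by
    rw [Finset.sum_add_distrib, Finset.sum_add_distrib, hp, hsum]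
    gcongr ?_ + 1
    simp only [mul_assoc, ← Finset.mul_sum]
    exact mul_le_mul_right heq _
  have hfin : ∀ τ ∈ Finset.univ, M⁻¹ * m τ * nlog (M⁻¹ * m τ) + M⁻¹ * m τ ≠ ⊤ := fun τ _ =>
    ENNReal.add_ne_top.2 ⟨ne_top_of_le_ne_top ENNReal.one_ne_top (mul_nlog_le_one (hle τ)),
      ne_top_of_le_ne_top ENNReal.one_ne_top (hle τ)⟩
  classical
  refine eq_of_gibbs_eq (hle τ) (hp1 τ) ?_
  by_contra hlt
  rw [not_le] at hlt
  refine absurd htot (not_le.2 ?_)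
  rw [← Finset.add_sum_erase _ _ (Finset.mem_univ τ), ← Finset.add_sum_erase _ _
    (Finset.mem_univ τ)]
  exact ENNReal.add_lt_add_of_lt_of_le
    (ENNReal.sum_ne_top.2 fun τ' h' => hfin τ' (Finset.mem_of_mem_erase h')) hlt
    (Finset.sum_le_sum fun τ' h' => h τ' (Finset.mem_of_mem_erase h'))

/-- With `r` and `q` the `g`-means of `v` and `w`, this says that
`∫ g w log (q v / (r w)) ≤ 0`. It holds pointwise up to `g (v q / r - w)`, which has mean `0`. -/
theorem lintegral_nlog_exchange {X : Type*} [MeasurableSpace X] {μ : Measure X}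
    {g w v : X → ℝ≥0∞} (hg : Measurable g) (hw : Measurable w) (hv : Measurable v)
    (hw1 : ∀ x, w x ≤ 1) (hv1 : ∀ x, v x ≤ 1) (hM : ∫⁻ x, g x ∂μ ≠ ⊤) :
    ∫⁻ x, g x * (w x * (nlog ((∫⁻ x, g x ∂μ)⁻¹ * ∫⁻ x, g x * v x ∂μ) + nlog (w x))) ∂μ ≤
      ∫⁻ x, g x * (w x * (nlog ((∫⁻ x, g x ∂μ)⁻¹ * ∫⁻ x, g x * w x ∂μ) + nlog (v x))) ∂μ := by
  set M := ∫⁻ x, g x ∂μ with hMdef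
  have hle : ∀ f : X → ℝ≥0∞, (∀ x, f x ≤ 1) → ∫⁻ x, g x * f x ∂μ ≤ M := fun f hf =>
    lintegral_mono fun x => mul_le_of_le_one_right' (hf x)
  have hle1 : ∀ f : X → ℝ≥0∞, (∀ x, f x ≤ 1) → M⁻¹ * ∫⁻ x, g x * f x ∂μ ≤ 1 := fun f hf => by
    rw [mul_comm, ← div_eq_mul_inv]
    exact ENNReal.div_le_of_le_mul (by simpa using hle f hf)
  have hr := hle1 v hv1
  have hq := hle1 w hw1
  set r := M⁻¹ * ∫⁻ x, g x * v x ∂μ with hrdef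
  set q := M⁻¹ * ∫⁻ x, g x * w x ∂μ with hqdef
  have hgwfin : ∫⁻ x, g x * w x ∂μ ≠ ⊤ := ne_top_of_le_ne_top hM (hle w hw1)
  rcases eq_or_ne r 0 with hr0 | hr0
  · -- where `g` is positive, `v` vanishes, so the right-hand side is infinite unless `w` vanishes
    have hgv : ∫⁻ x, g x * v x ∂μ = 0 :=
      (mul_eq_zero.1 hr0).resolve_left (ENNReal.inv_ne_zero.2 hM)
    rw [lintegral_eq_zero_iff (by fun_prop)] at hgv
    refine lintegral_mono_ae (hgv.mono fun x hx => ?_)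
    rcases mul_eq_zero.1 hx with h | h
    · simp [h]
    · rcases eq_or_ne (g x) 0 with h1 | h1
      · simp [h1]
      rcases eq_or_ne (w x) 0 with h2 | h2
      · simp [h2]
      simp [h, ENNReal.mul_top h1, ENNReal.mul_top h2]
  · have hM0 : M ≠ 0 := fun h0 => hr0 (by
      rw [hrdef, le_antisymm ((hle v hv1).trans_eq h0) zero_le, mul_zero])
    have hgv : ∫⁻ x, g x * v x ∂μ = M * r := by
      rw [hrdef, ← mul_assoc, ENNReal.mul_inv_cancel hM0 hM, one_mul]
    have hgw : ∫⁻ x, g x * w x ∂μ = M * q := by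
      rw [hqdef, ← mul_assoc, ENNReal.mul_inv_cancel hM0 hM, one_mul]
    have hrt : r ≠ ⊤ := ne_top_of_le_ne_top ENNReal.one_ne_top hr
    have h : ∀ x, g x * (w x * (nlog r + nlog (w x))) + g x * w x ≤
        g x * (w x * (nlog q + nlog (v x))) + g x * v x * (q * r⁻¹) := fun x => by
      have h := mul_le_mul_right (nlog_exchange (hw1 x) (hv1 x) hq hr hr0) (g x)
      rwa [mul_add, mul_add (g x), ← mul_assoc (g x) (v x)] at h
    have hi := lintegral_mono (μ := μ) h
    rw [lintegral_add_right _ (by fun_prop), lintegral_add_right _ (by fun_prop),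
      lintegral_mul_const _ (by fun_prop), hgv,
      show M * r * (q * r⁻¹) = M * q * (r * r⁻¹) by ring, ENNReal.mul_inv_cancel hr0 hrt, mul_one,
      ← hgw] at hi
    exact (ENNReal.add_le_add_iff_right hgwfin).1 hi

namespace Environment

variable {I Ω S : Type*} [MeasurableSpace I] [MeasurableSpace Ω] [Fintype S] [MeasurableSpace S]
  [MeasurableSingletonClass S]

/-! ### Entropies of the reported signal -/

/-- The prior probability of the private signal `σ`. -/
noncomputable def signalMass (E : Environment I Ω S) (σ : S) : ℝ≥0∞ :=
  ∫⁻ x, weight (E.W x) σ ∂E.P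

/-- The probability that an agent receives `σ` and a random other agent reports `τ`. -/
noncomputable def jointFreq (E : Environment I Ω S) (s : Profile I S) (σ τ : S) : ℝ≥0∞ :=
  ∫⁻ x, weight (E.W x) σ * E.reportFreq s (E.W x) τ ∂E.P

/-- The probability that a random agent reports `τ`, given the private signal `σ` of another agent.
It is `0` if `σ` has probability zero. -/
noncomputable def posteriorFreq (E : Environment I Ω S) (s : Profile I S) (σ τ : S) : ℝ≥0∞ :=
  (E.signalMass σ)⁻¹ * E.jointFreq s σ τ

/-- The conditional entropy of the report of a random agent given the state. -/
noncomputable def stateEntropy (E : Environment I Ω S) (s : Profile I S) : ℝ≥0∞ :=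
  ∑ τ, ∫⁻ x, E.reportFreq s (E.W x) τ * nlog (E.reportFreq s (E.W x) τ) ∂E.P

/-- The conditional entropy of the report of a random agent given the private signal of another
agent. -/
noncomputable def peerEntropy (E : Environment I Ω S) (s : Profile I S) : ℝ≥0∞ :=
  ∑ σ, ∑ τ, E.jointFreq s σ τ * nlog (E.posteriorFreq s σ τ)

omit [MeasurableSingletonClass S] in
theorem signalMass_le_one (E : Environment I Ω S) (σ : S) : E.signalMass σ ≤ 1 :=
  (lintegral_mono fun x => weight_le_one (E.W x) σ).trans (by simp)

omit [MeasurableSingletonClass S] in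
theorem signalMass_ne_top (E : Environment I Ω S) (σ : S) : E.signalMass σ ≠ ⊤ :=
  ne_top_of_le_ne_top ENNReal.one_ne_top (E.signalMass_le_one σ)

theorem sum_jointFreq (E : Environment I Ω S) (s : Profile I S) (σ : S) :
    ∑ τ, E.jointFreq s σ τ = E.signalMass σ := by
  unfold jointFreq signalMass
  rw [← lintegral_finsetSum _ fun τ _ => by fun_prop]
  simp only [← Finset.mul_sum, E.sum_reportFreq, mul_one]

theorem jointFreq_le (E : Environment I Ω S) (s : Profile I S) (σ τ : S) :
    E.jointFreq s σ τ ≤ E.signalMass σ := by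
  rw [← E.sum_jointFreq s σ]
  exact Finset.single_le_sum (f := fun τ => E.jointFreq s σ τ) (fun _ _ => zero_le)
    (Finset.mem_univ τ)

theorem posteriorFreq_le_one (E : Environment I Ω S) (s : Profile I S) (σ τ : S) :
    E.posteriorFreq s σ τ ≤ 1 := by
  rw [posteriorFreq, mul_comm, ← div_eq_mul_inv]
  exact ENNReal.div_le_of_le_mul (by simpa using E.jointFreq_le s σ τ)

theorem sum_posteriorFreq (E : Environment I Ω S) (s : Profile I S) {σ : S}
    (h0 : E.signalMass σ ≠ 0) : ∑ τ, E.posteriorFreq s σ τ = 1 := by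
  unfold posteriorFreq
  rw [← Finset.mul_sum, E.sum_jointFreq, ENNReal.inv_mul_cancel h0 (E.signalMass_ne_top σ)]

theorem signalMass_mul_posteriorFreq (E : Environment I Ω S) (s : Profile I S) (σ τ : S) :
    E.signalMass σ * E.posteriorFreq s σ τ = E.jointFreq s σ τ := by
  rcases eq_or_ne (E.signalMass σ) 0 with h0 | h0
  · rw [h0, zero_mul]
    exact (le_antisymm ((E.jointFreq_le s σ τ).trans_eq h0) zero_le).symm
  · rw [posteriorFreq, ← mul_assoc, ENNReal.mul_inv_cancel h0 (E.signalMass_ne_top σ), one_mul]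

theorem stateEntropy_ne_top (E : Environment I Ω S) (s : Profile I S) :
    E.stateEntropy s ≠ ⊤ := by
  refine ENNReal.sum_ne_top.2 fun τ _ => ne_top_of_le_ne_top ENNReal.one_ne_top
    ((lintegral_mono fun x => mul_nlog_le_one (E.reportFreq_le_one s (E.W x) τ)).trans ?_)
  simp

theorem peerEntropy_ne_top (E : Environment I Ω S) (s : Profile I S) :
    E.peerEntropy s ≠ ⊤ := by
  refine ENNReal.sum_ne_top.2 fun σ _ => ENNReal.sum_ne_top.2 fun τ _ => ?_
  rw [← signalMass_mul_posteriorFreq, mul_assoc]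
  exact ENNReal.mul_ne_top (E.signalMass_ne_top σ)
    (ne_top_of_le_ne_top ENNReal.one_ne_top (mul_nlog_le_one (E.posteriorFreq_le_one s σ τ)))

theorem sum_lintegral_weight_mul (E : Environment I Ω S) {f : Ω → ℝ≥0∞} (hf : Measurable f) :
    ∑ σ, ∫⁻ x, weight (E.W x) σ * f x ∂E.P = ∫⁻ x, f x ∂E.P := by
  rw [← lintegral_finsetSum _ fun σ _ => by fun_prop]
  refine lintegral_congr fun x => ?_
  rw [← Finset.sum_mul, sum_coord, one_mul]

theorem avgProb_truth [DecidableEq S] (E : Environment I Ω S) (ρ τ : S) :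
    E.avgProb E.truth ρ τ = if ρ = τ then 1 else 0 := by
  unfold avgProb truth
  split_ifs with h <;> simp [h]

theorem reportFreq_truth (E : Environment I Ω S) (w : Simplex S) (τ : S) :
    E.reportFreq E.truth w τ = weight w τ := by
  classical
  simp [reportFreq, avgProb_truth]

theorem reportProb_truth (E : Environment I Ω S) (j : I) (w : Simplex S) (τ : S) :
    reportProb E.truth j τ w = weight w τ := by
  classical
  have : ∀ ρ, volume {u : unitInterval | (E.truth.toFun j ρ u).1 = τ} =
      if ρ = τ then 1 else 0 := fun ρ => by
    unfold truth
    split_ifs with h <;> simp [h]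
  simp [reportProb, this]

/-- Information gain of truthful reports over garbled ones. A signal `ρ` is garbled into `τ` with
probability `A ρ τ`, and the garbled report is scored by `v τ` against the `v`-posterior. The choice
of `v` as the truthful frequencies gives the optimality of reporting the truth to truthful agents;
the choice of `v` as the garbled frequencies gives the data processing inequality. -/
theorem garbling_le (E : Environment I Ω S) {A : S → S → ℝ≥0∞} (hA : ∀ ρ, ∑ τ, A ρ τ = 1)
    {v : S → Ω → ℝ≥0∞} (hv : ∀ τ, Measurable (v τ)) (hv1 : ∀ τ x, v τ x ≤ 1) :
    (∑ σ, ∑ τ, (∫⁻ x, weight (E.W x) σ * ∑ ρ, weight (E.W x) ρ * A ρ τ ∂E.P) *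
        nlog ((E.signalMass σ)⁻¹ * ∫⁻ x, weight (E.W x) σ * v τ x ∂E.P)) +
        E.stateEntropy E.truth ≤
      E.peerEntropy E.truth +
        ∑ τ, ∫⁻ x, (∑ ρ, weight (E.W x) ρ * A ρ τ) * nlog (v τ x) ∂E.P := by
  have hsplit : ∀ (σ ρ : S) (c : ℝ≥0∞) (f : Ω → ℝ≥0∞), Measurable f →
      ∫⁻ x, weight (E.W x) σ * (weight (E.W x) ρ * (c + f x)) ∂E.P =
      (∫⁻ x, weight (E.W x) σ * weight (E.W x) ρ ∂E.P) * c +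
        ∫⁻ x, weight (E.W x) σ * (weight (E.W x) ρ * f x) ∂E.P := fun σ ρ c f hf => by
    simp only [mul_add]
    rw [lintegral_add_right _ (by fun_prop), ← lintegral_mul_const _ (by fun_prop)]
    simp only [mul_assoc]
  have hnw : ∀ ρ, Measurable fun x => nlog (weight (E.W x) ρ) := fun ρ => by fun_prop
  have hnv : ∀ τ, Measurable fun x => nlog (v τ x) := fun τ => measurable_nlog.comp (hv τ)
  have key := fun σ ρ τ => lintegral_nlog_exchange (μ := E.P)
    (E.measurable_weight σ) (E.measurable_weight ρ) (hv τ) (fun x => weight_le_one _ _) (hv1 τ)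
    (E.signalMass_ne_top σ)
  simp only [fun σ ρ τ c => hsplit σ ρ c _ (hnw τ), fun σ ρ τ c => hsplit σ ρ c _ (hnv τ)] at key
  have key2 := Finset.sum_le_sum fun σ (_ : σ ∈ (Finset.univ : Finset S)) =>
    Finset.sum_le_sum fun ρ (_ : ρ ∈ (Finset.univ : Finset S)) =>
      Finset.sum_le_sum fun τ (_ : τ ∈ (Finset.univ : Finset S)) =>
        mul_le_mul_right (key σ ρ τ) (A ρ τ)
  simp only [mul_add, Finset.sum_add_distrib] at key2
  refine (congrArg₂ (· + ·) ?_ ?_).trans_le (key2.trans_eq (congrArg₂ (· + ·) ?_ ?_))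
  · refine Finset.sum_congr rfl fun σ _ => ?_
    rw [Finset.sum_comm]
    refine Finset.sum_congr rfl fun τ _ => ?_
    simp only [Finset.mul_sum]
    rw [lintegral_finsetSum _ fun ρ _ => by fun_prop, Finset.sum_mul]
    refine Finset.sum_congr rfl fun ρ _ => ?_
    simp only [← mul_assoc]
    rw [lintegral_mul_const _ (by fun_prop), mul_comm _ (A ρ τ), signalMass]
  · simp only [← Finset.sum_mul, hA, one_mul]
    rw [Finset.sum_comm]
    simp only [stateEntropy, reportFreq_truth]
    exact Finset.sum_congr rfl fun ρ _ =>
      (E.sum_lintegral_weight_mul (by fun_prop)).symm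
  · simp only [← Finset.sum_mul, hA, one_mul, peerEntropy, posteriorFreq, jointFreq,
      reportFreq_truth, signalMass]
  · have hR : ∀ τ, ∫⁻ x, (∑ ρ, weight (E.W x) ρ * A ρ τ) * nlog (v τ x) ∂E.P =
        ∑ ρ, ∫⁻ x, weight (E.W x) ρ * A ρ τ * nlog (v τ x) ∂E.P := fun τ => by
      simp only [Finset.sum_mul]
      exact lintegral_finsetSum _ fun ρ _ =>
        ((E.measurable_weight ρ).mul_const (A ρ τ)).mul (hnv τ)
    have hL : ∀ ρ, ∑ σ, ∑ τ, A ρ τ *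
        ∫⁻ x, weight (E.W x) σ * (weight (E.W x) ρ * nlog (v τ x)) ∂E.P =
        ∑ τ, ∫⁻ x, weight (E.W x) ρ * A ρ τ * nlog (v τ x) ∂E.P := fun ρ => by
      rw [Finset.sum_comm]
      refine Finset.sum_congr rfl fun τ _ => ?_
      have hm : Measurable fun x => weight (E.W x) ρ * nlog (v τ x) :=
        (E.measurable_weight ρ).mul (hnv τ)
      rw [← Finset.mul_sum, E.sum_lintegral_weight_mul hm, ← lintegral_const_mul _ hm]
      exact lintegral_congr fun x => by ring
    rw [Finset.sum_comm, Finset.sum_congr rfl fun ρ _ => hL ρ,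
      Finset.sum_congr rfl fun τ _ => hR τ]
    exact Finset.sum_comm

/-- The data processing inequality: garbled reports carry less information than the truth. -/
theorem peerEntropy_add_stateEntropy_truth_le (E : Environment I Ω S) (s : Profile I S) :
    E.peerEntropy s + E.stateEntropy E.truth ≤ E.peerEntropy E.truth + E.stateEntropy s :=
  E.garbling_le (E.sum_avgProb s) (v := fun τ x => E.reportFreq s (E.W x) τ)
    (fun τ => E.measurable_reportFreq_W s τ) fun τ x => E.reportFreq_le_one s (E.W x) τ

end Environment

/-! ### Expected scores -/

theorem scorePre_eq {S : Type*} [Fintype S] (fr : Simplex S) (r r' : Report S) :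
    scorePre fr r r' = (nlog (weight fr r'.1) : EReal) - (nlog (weight r.2 r'.1) : EReal) := by
  have h : ∀ (w : Simplex S) σ, w.1 σ ≤ 1 := fun w σ => by simpa using weight_le_one w σ
  rw [scorePre, elog_eq_neg_nlog (h _ _), elog_eq_neg_nlog (h _ _), sub_eq_add_neg, neg_neg,
    add_comm, ← sub_eq_add_neg]

theorem scoreIm_eq {S : Type*} [Fintype S] (fr : Simplex S) (r r' : Report S) :
    scoreIm fr r r' = (nlog (weight r'.2 r.1) : EReal) - (nlog (weight fr r.1) : EReal) := by
  have h : ∀ (w : Simplex S) σ, w.1 σ ≤ 1 := fun w σ => by simpa using weight_le_one w σ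
  rw [scoreIm, elog_eq_neg_nlog (h _ _), elog_eq_neg_nlog (h _ _), sub_eq_add_neg, neg_neg,
    add_comm, ← sub_eq_add_neg]

/-- The probability that an agent who plays `t` reports `τ` when the state is `w`. -/
noncomputable def Strategy.prob {S : Type*} [Fintype S] [MeasurableSpace S] (t : Strategy S)
    (τ : S) (w : Simplex S) : ℝ≥0∞ :=
  ∑ ρ, weight w ρ * volume {u | (t.toFun ρ u).1 = τ}

namespace Environment

variable {I Ω S : Type*} [MeasurableSpace I] [MeasurableSpace Ω] [Fintype S] [MeasurableSpace S]
  [MeasurableSingletonClass S]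

@[fun_prop]
theorem measurable_prob_W (E : Environment I Ω S) (t : Strategy S) (τ : S) :
    Measurable fun x => t.prob τ (E.W x) := by
  unfold Strategy.prob
  fun_prop

theorem prob_le_one (t : Strategy S) (τ : S) (w : Simplex S) : t.prob τ w ≤ 1 :=
  reportProb_le_one (Profile.const t : Profile Unit S) () τ w

theorem sum_volume_report (t : Strategy S) (ρ : S) :
    ∑ τ : S, volume {u | (t.toFun ρ u).1 = τ} = 1 := by
  rw [← tsum_fintype (L := SummationFilter.unconditional _), ← measure_iUnion]
  · have : (⋃ τ : S, {u | (t.toFun ρ u).1 = τ}) = univ := by ext u; simp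
    rw [this, measure_univ]
  · intro τ τ' h
    exact Set.disjoint_left.2 fun u hu hu' => h (hu.symm.trans hu')
  · exact fun τ => measurableSet_seed (Profile.const t : Profile Unit S) () ρ τ

@[fun_prop]
theorem measurable_weight_prediction (t : Strategy S) (σ τ : S) :
    Measurable fun u => weight (t.toFun σ u).2 τ :=
  (measurable_coord τ).comp (measurable_snd.comp (t.measurable_toFun σ))

theorem measurable_reported_signal (E : Environment I Ω S) (t : Strategy S) (i : I) :
    Measurable fun x => (E.report t i x).1 :=
  measurable_to_countable' fun τ => E.measurableSet_report (Profile.const t) i τ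

theorem measurable_report (E : Environment I Ω S) (t : Strategy S) (i : I) :
    Measurable (E.report t i) := by
  have h : Measurable fun p : S × unitInterval => t.toFun p.1 p.2 :=
    measurable_from_prod_countable_right fun σ => t.measurable_toFun σ
  exact h.comp ((E.measurable_Ψ i).prodMk (E.measurable_U i))

theorem measurable_apply_signal {X : Type*} [MeasurableSpace X] {r : X → S} (hr : Measurable r)
    {f : S → X → ℝ≥0∞} (hf : ∀ τ, Measurable (f τ)) : Measurable fun x => f (r x) x := by
  have h : Measurable fun p : S × X => f p.1 p.2 := measurable_from_prod_countable_right hf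
  exact h.comp (hr.prodMk measurable_id)

/-- The expected prediction loss `-log p` of an agent who plays `t` against the profile `s`. -/
noncomputable def predictionLoss (E : Environment I Ω S) (s : Profile I S) (t : Strategy S) :
    ℝ≥0∞ :=
  ∑ σ, ∑ τ, E.jointFreq s σ τ * ∫⁻ u, nlog (weight (t.toFun σ u).2 τ)

/-- The expected value of `-log q(τ)`, where `τ` is the report of an agent who plays `t` and `q` is
the posterior of another agent for the reports under `s`. -/
noncomputable def peerLoss (E : Environment I Ω S) (s : Profile I S) (t : Strategy S) : ℝ≥0∞ :=
  ∑ σ, ∑ τ, (∫⁻ x, t.prob τ (E.W x) * weight (E.W x) σ ∂E.P) * nlog (E.posteriorFreq s σ τ)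

/-- The expected value of `-log Ŵ(τ)`, where `τ` is the report of an agent who plays `t` and `Ŵ` is
the distribution of the reports under `s`. -/
noncomputable def stateLoss (E : Environment I Ω S) (s : Profile I S) (t : Strategy S) : ℝ≥0∞ :=
  ∑ τ, ∫⁻ x, t.prob τ (E.W x) * nlog (E.reportFreq s (E.W x) τ) ∂E.P

theorem measurable_stateLoss (E : Environment I Ω S) (s : Profile I S) :
    Measurable fun j => E.stateLoss s (s.strategy j) :=
  Finset.measurable_sum _ fun τ _ => E.measurable_lintegral_reportProb_mul s τ
    (f := fun x => nlog (E.reportFreq s (E.W x) τ)) (by fun_prop)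

theorem lintegral_stateLoss (E : Environment I Ω S) (s : Profile I S) :
    ∫⁻ j, E.stateLoss s (s.strategy j) ∂E.pop = E.stateEntropy s := by
  unfold stateLoss
  refine (lintegral_finsetSum _ fun τ _ => E.measurable_lintegral_reportProb_mul s τ
    (f := fun x => nlog (E.reportFreq s (E.W x) τ)) (by fun_prop)).trans ?_
  exact Finset.sum_congr rfl fun τ _ => E.lintegral_lintegral_reportProb_mul s τ
    (f := fun x => nlog (E.reportFreq s (E.W x) τ)) (by fun_prop)

theorem measurable_lintegral_prob_mul_weight (E : Environment I Ω S) (s : Profile I S) (σ τ : S) :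
    Measurable fun j => ∫⁻ x, (s.strategy j).prob τ (E.W x) * weight (E.W x) σ ∂E.P :=
  E.measurable_lintegral_reportProb_mul s τ (E.measurable_weight σ)

theorem lintegral_prob_mul_weight (E : Environment I Ω S) (s : Profile I S) (σ τ : S) :
    ∫⁻ j, ∫⁻ x, (s.strategy j).prob τ (E.W x) * weight (E.W x) σ ∂E.P ∂E.pop =
      E.jointFreq s σ τ := by
  refine (E.lintegral_lintegral_reportProb_mul s τ (E.measurable_weight σ)).trans ?_
  exact lintegral_congr fun x => mul_comm _ _

theorem measurable_peerLoss (E : Environment I Ω S) (s : Profile I S) :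
    Measurable fun j => E.peerLoss s (s.strategy j) :=
  Finset.measurable_sum _ fun σ _ => Finset.measurable_sum _ fun τ _ =>
    (E.measurable_lintegral_prob_mul_weight s σ τ).mul_const _

theorem lintegral_peerLoss (E : Environment I Ω S) (s : Profile I S) :
    ∫⁻ j, E.peerLoss s (s.strategy j) ∂E.pop = E.peerEntropy s := by
  unfold peerLoss
  rw [lintegral_finsetSum _ fun σ _ => Finset.measurable_sum _ fun τ _ =>
    (E.measurable_lintegral_prob_mul_weight s σ τ).mul_const _]
  refine Finset.sum_congr rfl fun σ _ => ?_
  rw [lintegral_finsetSum _ fun τ _ => (E.measurable_lintegral_prob_mul_weight s σ τ).mul_const _]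
  refine Finset.sum_congr rfl fun τ _ => ?_
  rw [lintegral_mul_const _ (E.measurable_lintegral_prob_mul_weight s σ τ),
    E.lintegral_prob_mul_weight]

/-- `lintegral_report_pair` for a loss that does not depend on the first agent. -/
theorem lintegral_report_state (E : Environment I Ω S) (t : Strategy S) {i j : I} (hij : i ≠ j)
    {f : S → Simplex S → ℝ≥0∞} (hf : ∀ τ, Measurable (f τ)) :
    ∫⁻ x, f (E.report t j x).1 (E.W x) ∂E.P =
      ∑ τ, ∫⁻ x, t.prob τ (E.W x) * f τ (E.W x) ∂E.P := by
  have h := E.lintegral_report_pair (Profile.const t) hij (F := fun τ _ w _ => f τ w)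
    fun τ _ => (hf τ).comp measurable_fst
  refine h.trans ?_
  rw [Finset.sum_comm]
  refine Finset.sum_congr rfl fun τ _ => ?_
  rw [← E.sum_lintegral_weight_mul (f := fun x => t.prob τ (E.W x) * f τ (E.W x))
    ((E.measurable_prob_W t τ).mul ((hf τ).comp E.measurable_W))]
  refine Finset.sum_congr rfl fun σ _ => lintegral_congr fun x => ?_
  rw [lintegral_const, measure_univ, mul_one, mul_assoc]
  rfl

omit [MeasurableSingletonClass S] in
theorem ae_ne (E : Environment I Ω S) (i : I) : ∀ᵐ j ∂E.pop, j ≠ i := by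
  simpa using measure_eq_zero_iff_ae_notMem.1 (measure_singleton (μ := E.pop) i)

/-- The prediction score is a loss that depends on the agent's strategy, subtracted from an entropy
that does not. -/
theorem predictionScore_eq (E : Environment I Ω S) (s : Profile I S) (i : I) (t : Strategy S) :
    E.predictionScore s i t = (E.stateEntropy s : EReal) - (E.predictionLoss s t : EReal) := by
  set n : I → ℝ≥0∞ := fun j => ∑ σ, ∑ τ,
    (∫⁻ x, (s.strategy j).prob τ (E.W x) * weight (E.W x) σ ∂E.P) *
      ∫⁻ u, nlog (weight (t.toFun σ u).2 τ) with hn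
  have hnm : ∀ σ τ, Measurable fun j =>
      (∫⁻ x, (s.strategy j).prob τ (E.W x) * weight (E.W x) σ ∂E.P) *
      ∫⁻ u, nlog (weight (t.toFun σ u).2 τ) := fun σ τ =>
    (E.measurable_lintegral_prob_mul_weight s σ τ).mul_const _
  have hni : ∫⁻ j, n j ∂E.pop = E.predictionLoss s t := by
    rw [hn, lintegral_finsetSum _ fun σ _ => Finset.measurable_sum _ fun τ _ => hnm σ τ]
    refine Finset.sum_congr rfl fun σ _ => ?_
    rw [lintegral_finsetSum _ fun τ _ => hnm σ τ]
    refine Finset.sum_congr rfl fun τ _ => ?_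
    rw [lintegral_mul_const _ (E.measurable_lintegral_prob_mul_weight s σ τ),
      E.lintegral_prob_mul_weight]
  have hfin : ∀ᵐ j ∂E.pop, E.stateLoss s (s.strategy j) < ⊤ :=
    ae_lt_top (E.measurable_stateLoss s) (by
      rw [E.lintegral_stateLoss]; exact E.stateEntropy_ne_top s)
  have hj : ∀ᵐ j ∂E.pop, (emean E.P fun x =>
      scorePre (E.reportDist s x) (E.report t i x) (E.report (s.strategy j) j x)) =
      (E.stateLoss s (s.strategy j) : EReal) - (n j : EReal) := by
    filter_upwards [hfin, E.ae_ne i] with j hj hji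
    have hr := E.measurable_reported_signal (s.strategy j) j
    have hae : (fun x =>
        scorePre (E.reportDist s x) (E.report t i x) (E.report (s.strategy j) j x)) =ᵐ[E.P]
        fun x => (nlog (E.reportFreq s (E.W x) (E.report (s.strategy j) j x).1) : EReal) -
          (nlog (weight (E.report t i x).2 (E.report (s.strategy j) j x).1) : EReal) := by
      filter_upwards [E.weight_reportDist s] with x hx
      rw [scorePre_eq, hx]
    have hP : ∫⁻ x, nlog (E.reportFreq s (E.W x) (E.report (s.strategy j) j x).1) ∂E.P =
        E.stateLoss s (s.strategy j) :=
      E.lintegral_report_state (s.strategy j) hji.symm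
        (f := fun τ w => nlog (E.reportFreq s w τ))
        fun τ => measurable_nlog.comp (E.measurable_reportFreq s τ)
    have hN : ∫⁻ x, nlog (weight (E.report t i x).2 (E.report (s.strategy j) j x).1) ∂E.P =
        n j := by
      refine (E.lintegral_report_pair s hji.symm
        (F := fun τ σ _ u => nlog (weight (t.toFun σ u).2 τ))
        fun τ σ => (measurable_nlog.comp (measurable_weight_prediction t σ τ)).comp
          measurable_snd).trans ?_
      refine Finset.sum_congr rfl fun σ _ => Finset.sum_congr rfl fun τ _ => ?_
      rw [lintegral_mul_const _ (by fun_prop)]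
      congr 1
      exact lintegral_congr fun x => mul_comm _ _
    rw [emean_congr_ae hae, emean_coe_sub, hP, hN]
    · exact (measurable_apply_signal hr fun τ =>
        measurable_nlog.comp (E.measurable_reportFreq_W s τ)).aemeasurable
    · exact (measurable_apply_signal hr (f := fun τ x => nlog (weight (E.report t i x).2 τ))
        fun τ => measurable_nlog.comp ((measurable_coord τ).comp
          (measurable_snd.comp (E.measurable_report t i)))).aemeasurable
    · exact Or.inl (by rw [hP]; exact hj.ne)
  rw [predictionScore, emean_congr_ae hj, emean_coe_sub (E.measurable_stateLoss s).aemeasurable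
    (Finset.measurable_sum _ fun σ _ => Finset.measurable_sum _ fun τ _ => hnm σ τ).aemeasurable
    (Or.inl (by rw [E.lintegral_stateLoss]; exact E.stateEntropy_ne_top s)),
    E.lintegral_stateLoss, hni]

/-! ### Calibrated profiles and equilibria -/

/-- A profile is calibrated if almost surely every agent predicts her posterior expectation of the
distribution of reports. Signals of probability zero are not constrained. -/
def IsCalibrated (E : Environment I Ω S) (s : Profile I S) : Prop :=
  ∀ i σ, E.signalMass σ ≠ 0 →
    ∀ᵐ u : unitInterval, ∀ τ, weight (s.toFun i σ u).2 τ = E.posteriorFreq s σ τ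

theorem IsCalibrated.ae_prediction {E : Environment I Ω S} {s : Profile I S}
    (hs : E.IsCalibrated s) (j : I) :
    ∀ᵐ x ∂E.P, ∀ τ, weight (E.report (s.strategy j) j x).2 τ = E.posteriorFreq s (E.Ψ j x) τ := by
  have hm : ∀ σ, MeasurableSet
      {u | ¬ ∀ τ, weight (s.toFun j σ u).2 τ = E.posteriorFreq s σ τ} := fun σ => by
    have h : {u | ∀ τ, weight (s.toFun j σ u).2 τ = E.posteriorFreq s σ τ} =
        ⋂ τ, {u | weight (s.toFun j σ u).2 τ = E.posteriorFreq s σ τ} := by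
      ext u; simp
    rw [← compl_ofPred, h]
    exact (MeasurableSet.iInter fun τ => measurableSet_eq_fun
      (measurable_weight_prediction (s.strategy j) σ τ) measurable_const).compl
  have h0 : ∀ σ, E.P {x | E.Ψ j x = σ ∧ E.U j x ∈
      {u | ¬ ∀ τ, weight (s.toFun j σ u).2 τ = E.posteriorFreq s σ τ}} = 0 := fun σ => by
    have h := E.single_law j σ (hm σ) MeasurableSet.univ
    rw [preimage_univ, univ_inter, setLIntegral_univ, lintegral_mul_const _ (by fun_prop)] at h
    rw [h]
    by_cases hσ : E.signalMass σ = 0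
    · exact mul_eq_zero_of_left hσ _
    · exact mul_eq_zero_of_right _ (ae_iff.1 (hs j σ hσ))
  have h1 : ∀ᵐ x ∂E.P, ∀ σ, ¬ (E.Ψ j x = σ ∧ E.U j x ∈
      {u | ¬ ∀ τ, weight (s.toFun j σ u).2 τ = E.posteriorFreq s σ τ}) :=
    ae_all_iff.2 fun σ => measure_eq_zero_iff_ae_notMem.1 (h0 σ)
  filter_upwards [h1] with x hx
  have h2 := hx (E.Ψ j x)
  simp only [true_and, not_not] at h2
  exact h2

/-- The information score of a strategy against one reference agent in a calibrated profile. -/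
theorem IsCalibrated.emean_scoreIm {E : Environment I Ω S} {s : Profile I S}
    (hs : E.IsCalibrated s) {i j : I} (hij : j ≠ i) (t : Strategy S)
    (h : E.peerLoss s t ≠ ⊤ ∨ E.stateLoss s t ≠ ⊤) :
    (emean E.P fun x =>
      scoreIm (E.reportDist s x) (E.report t i x) (E.report (s.strategy j) j x)) =
      (E.peerLoss s t : EReal) - (E.stateLoss s t : EReal) := by
  have hr := E.measurable_reported_signal t i
  have hae : (fun x =>
      scoreIm (E.reportDist s x) (E.report t i x) (E.report (s.strategy j) j x)) =ᵐ[E.P]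
      fun x => (nlog (E.posteriorFreq s (E.Ψ j x) (E.report t i x).1) : EReal) -
        (nlog (E.reportFreq s (E.W x) (E.report t i x).1) : EReal) := by
    filter_upwards [E.weight_reportDist s, hs.ae_prediction j] with x hx hx'
    rw [scoreIm_eq, hx, hx']
  have hN : ∫⁻ x, nlog (E.reportFreq s (E.W x) (E.report t i x).1) ∂E.P = E.stateLoss s t :=
    E.lintegral_report_state t hij (f := fun τ w => nlog (E.reportFreq s w τ))
      fun τ => measurable_nlog.comp (E.measurable_reportFreq s τ)
  have hP : ∫⁻ x, nlog (E.posteriorFreq s (E.Ψ j x) (E.report t i x).1) ∂E.P =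
      E.peerLoss s t := by
    refine (E.lintegral_report_pair (Profile.const t) hij
      (F := fun τ σ _ _ => nlog (E.posteriorFreq s σ τ)) fun τ σ => measurable_const).trans ?_
    refine Finset.sum_congr rfl fun σ _ => Finset.sum_congr rfl fun τ _ => ?_
    rw [← lintegral_mul_const _ (by fun_prop)]
    refine lintegral_congr fun x => ?_
    rw [lintegral_const, measure_univ, mul_one, mul_comm (Strategy.prob _ _ _)]
    rfl
  rw [emean_congr_ae hae, emean_coe_sub, hP, hN]
  · have hm : Measurable fun p : S × S => nlog (E.posteriorFreq s p.1 p.2) :=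
      measurable_of_countable _
    exact (hm.comp ((E.measurable_Ψ j).prodMk hr)).aemeasurable
  · exact (measurable_apply_signal hr fun τ =>
      measurable_nlog.comp (E.measurable_reportFreq_W s τ)).aemeasurable
  · rwa [hP, hN]

theorem IsCalibrated.informationScore_eq {E : Environment I Ω S} {s : Profile I S}
    (hs : E.IsCalibrated s) (i : I) (t : Strategy S)
    (h : E.peerLoss s t ≠ ⊤ ∨ E.stateLoss s t ≠ ⊤) :
    E.informationScore s i t = (E.peerLoss s t : EReal) - (E.stateLoss s t : EReal) :=
  emean_eq_const ((E.ae_ne i).mono fun _ hj => hs.emean_scoreIm hj t h)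

theorem posteriorFreq_weight_eq (E : Environment I Ω S) (s : Profile I S) {σ : S}
    (hσ : E.signalMass σ ≠ 0) : ∃ q : Simplex S, ∀ τ, weight q τ = E.posteriorFreq s σ τ := by
  have hne : ∀ τ, E.posteriorFreq s σ τ ≠ ⊤ := fun τ =>
    ne_top_of_le_ne_top ENNReal.one_ne_top (E.posteriorFreq_le_one s σ τ)
  refine ⟨⟨fun τ => (E.posteriorFreq s σ τ).toReal, fun _ => ENNReal.toReal_nonneg, ?_⟩,
    fun τ => ENNReal.ofReal_toReal (hne τ)⟩
  rw [← ENNReal.toReal_sum fun τ _ => hne τ, E.sum_posteriorFreq s hσ, ENNReal.toReal_one]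

theorem jointFreq_eq_zero (E : Environment I Ω S) (s : Profile I S) {σ : S}
    (hσ : E.signalMass σ = 0) (τ : S) : E.jointFreq s σ τ = 0 :=
  le_antisymm ((E.jointFreq_le s σ τ).trans_eq hσ) zero_le

theorem sum_jointFreq_mul_nlog_le (E : Environment I Ω S) (s : Profile I S) (σ : S)
    (q : Simplex S) :
    ∑ τ, E.jointFreq s σ τ * nlog (E.posteriorFreq s σ τ) ≤
      ∑ τ, E.jointFreq s σ τ * nlog (weight q τ) := by
  have h := sum_mul_nlog_le (m := E.jointFreq s σ) (p := weight q)
    (by rw [E.sum_jointFreq]; exact E.signalMass_ne_top σ) (sum_coord q)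
  simpa only [E.sum_jointFreq, posteriorFreq] using h

theorem predictionLoss_eq (E : Environment I Ω S) (s : Profile I S) (t : Strategy S) :
    E.predictionLoss s t =
      ∑ σ, ∫⁻ u, ∑ τ, E.jointFreq s σ τ * nlog (weight (t.toFun σ u).2 τ) := by
  refine Finset.sum_congr rfl fun σ _ => ?_
  rw [lintegral_finsetSum _ fun τ _ => by fun_prop]
  exact Finset.sum_congr rfl fun τ _ => (lintegral_const_mul _ (by fun_prop)).symm

/-- The logarithmic scoring rule is proper, so the posterior minimizes the prediction loss. -/
theorem peerEntropy_le_predictionLoss (E : Environment I Ω S) (s : Profile I S)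
    (t : Strategy S) : E.peerEntropy s ≤ E.predictionLoss s t := by
  rw [predictionLoss_eq]
  refine Finset.sum_le_sum fun σ _ => ?_
  refine le_trans ?_ (lintegral_mono fun u => E.sum_jointFreq_mul_nlog_le s σ (t.toFun σ u).2)
  simp

theorem predictionLoss_of_calibrated (E : Environment I Ω S) (s : Profile I S) (t : Strategy S)
    (h : ∀ σ, E.signalMass σ ≠ 0 →
      ∀ᵐ u : unitInterval, ∀ τ, weight (t.toFun σ u).2 τ = E.posteriorFreq s σ τ) :
    E.predictionLoss s t = E.peerEntropy s := by
  refine Finset.sum_congr rfl fun σ _ => Finset.sum_congr rfl fun τ _ => ?_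
  by_cases hσ : E.signalMass σ = 0
  · simp [E.jointFreq_eq_zero s hσ]
  · rw [lintegral_congr_ae (g := fun _ => nlog (E.posteriorFreq s σ τ))
      ((h σ hσ).mono fun u hu => by simp only [hu τ])]
    simp

/-- Only the posterior attains the minimal prediction loss. -/
theorem ae_eq_posteriorFreq_of_predictionLoss_le (E : Environment I Ω S) (s : Profile I S)
    (t : Strategy S) (h : E.predictionLoss s t ≤ E.peerEntropy s) {σ : S}
    (hσ : E.signalMass σ ≠ 0) :
    ∀ᵐ u : unitInterval, ∀ τ, weight (t.toFun σ u).2 τ = E.posteriorFreq s σ τ := by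
  classical
  have hfin := E.peerEntropy_ne_top s
  rw [predictionLoss_eq] at h
  set c : S → ℝ≥0∞ := fun σ => ∑ τ, E.jointFreq s σ τ * nlog (E.posteriorFreq s σ τ) with hc
  set l : S → unitInterval → ℝ≥0∞ :=
    fun σ u => ∑ τ, E.jointFreq s σ τ * nlog (weight (t.toFun σ u).2 τ) with hl
  have hcl : ∀ σ u, c σ ≤ l σ u := fun σ u => E.sum_jointFreq_mul_nlog_le s σ _
  have hcl' : ∀ σ, c σ ≤ ∫⁻ u, l σ u := fun σ => by
    refine le_trans ?_ (lintegral_mono fun u => hcl σ u)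
    simp
  have hcfin : ∀ σ, c σ ≠ ⊤ := fun σ => (ENNReal.sum_ne_top.1 hfin) σ (Finset.mem_univ σ)
  have hσle : ∫⁻ u, l σ u ≤ ∫⁻ _ : unitInterval, c σ := by
    rw [lintegral_const, measure_univ, mul_one]
    by_contra hlt
    rw [not_le] at hlt
    refine absurd h (not_le.2 ?_)
    change ∑ σ, c σ < ∑ σ, ∫⁻ u, l σ u
    rw [← Finset.add_sum_erase _ _ (Finset.mem_univ σ), ← Finset.add_sum_erase _ _
      (Finset.mem_univ σ)]
    exact ENNReal.add_lt_add_of_lt_of_le (ENNReal.sum_ne_top.2 fun σ' _ => hcfin σ') hlt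
      (Finset.sum_le_sum fun σ' _ => hcl' σ')
  have hae : (fun _ => c σ) =ᵐ[volume] l σ := by
    refine ae_eq_of_ae_le_of_lintegral_le (ae_of_all _ (hcl σ)) (by simpa using hcfin σ) ?_ hσle
    exact (Finset.measurable_sum _ fun τ _ => by fun_prop).aemeasurable
  filter_upwards [hae] with u hu τ
  have h1 := eq_of_sum_mul_nlog_le (m := E.jointFreq s σ) (p := weight (t.toFun σ u).2)
    (by rw [E.sum_jointFreq]; exact E.signalMass_ne_top σ)
    (by rwa [E.sum_jointFreq]) (sum_coord _)
    (by rw [E.sum_jointFreq]; exact hu.symm.le) τ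
  rw [h1, E.sum_jointFreq, posteriorFreq]

/-- The strategy that reports signals as `t` does, but predicts the posterior. -/
theorem exists_calibrated_strategy (E : Environment I Ω S) (s : Profile I S) (t : Strategy S) :
    ∃ t' : Strategy S, (∀ σ u, (t'.toFun σ u).1 = (t.toFun σ u).1) ∧
      E.predictionLoss s t' = E.peerEntropy s := by
  classical
  have h : ∀ σ, ∃ f : unitInterval → Report S, Measurable f ∧
      (∀ u, (f u).1 = (t.toFun σ u).1) ∧
      (E.signalMass σ ≠ 0 → ∀ u τ, weight (f u).2 τ = E.posteriorFreq s σ τ) := fun σ => by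
    by_cases hσ : E.signalMass σ = 0
    · exact ⟨t.toFun σ, t.measurable_toFun σ, fun _ => rfl, fun h => absurd hσ h⟩
    · obtain ⟨q, hq⟩ := E.posteriorFreq_weight_eq s hσ
      exact ⟨fun u => ((t.toFun σ u).1, q),
        (measurable_fst.comp (t.measurable_toFun σ)).prodMk measurable_const, fun _ => rfl,
        fun _ _ τ => hq τ⟩
  choose f hf h1 h2 using h
  exact ⟨⟨f, hf⟩, h1, E.predictionLoss_of_calibrated s _ fun σ hσ => ae_of_all _ (h2 σ hσ)⟩

/-- In an equilibrium every agent predicts her posterior: the prediction affects only her prediction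
score, and the logarithmic scoring rule is strictly proper. -/
theorem IsEquilibrium.isCalibrated {E : Environment I Ω S} {α : ℝ}
    {s : Profile I S} (hs : E.IsEquilibrium α s) : E.IsCalibrated s := by
  intro i σ hσ
  refine E.ae_eq_posteriorFreq_of_predictionLoss_le s (s.strategy i) ?_ hσ
  obtain ⟨t, ht, htl⟩ := E.exists_calibrated_strategy s (s.strategy i)
  obtain ⟨⟨hb, htop⟩, hmax⟩ := hs i
  have hle := hmax t
  have hinfo : E.informationScore s i t = E.informationScore s i (s.strategy i) := by
    have : ∀ x r', scoreIm (E.reportDist s x) (E.report t i x) r' =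
        scoreIm (E.reportDist s x) (E.report (s.strategy i) i x) r' := fun x r' => by
      rw [scoreIm, scoreIm, report, ht, report]
    simp only [informationScore, this]
  unfold payment at hb htop hle
  rw [hinfo, predictionScore_eq, predictionScore_eq, htl] at hle
  rw [predictionScore_eq] at hb htop
  have hH := E.stateEntropy_ne_top s
  have hC := E.peerEntropy_ne_top s
  generalize E.stateEntropy s = H at *
  generalize E.peerEntropy s = C at *
  generalize E.predictionLoss s (s.strategy i) = L at *
  generalize (α : EReal) * E.informationScore s i (s.strategy i) = y at *
  lift H to NNReal using hH
  lift C to NNReal using hC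
  rcases eq_or_ne L ⊤ with rfl | hL
  · exact absurd (by simp [EReal.sub_top]) hb
  lift L to NNReal using hL
  simp only [EReal.coe_nnreal_eq_coe_real, ← EReal.coe_sub] at hb htop hle
  induction y using EReal.rec with
  | bot => exact absurd (by simp) hb
  | top => exact absurd (EReal.add_top_of_ne_bot (EReal.coe_ne_bot _)) htop
  | coe y =>
    norm_cast at hle
    have : (L : ℝ) ≤ C := by linarith
    exact_mod_cast this

/-! ### Truth-telling -/

theorem reportDist_truth (E : Environment I Ω S) :
    ∀ᵐ x ∂E.P, E.reportDist E.truth x = E.W x := by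
  filter_upwards [E.weight_reportDist E.truth] with x hx
  refine Subtype.ext (funext fun τ => ?_)
  have h := hx τ
  rw [reportFreq_truth] at h
  exact (ENNReal.ofReal_eq_ofReal_iff ((E.reportDist E.truth x).2.1 τ) ((E.W x).2.1 τ)).1 h

theorem posterior_eq_posteriorFreq (E : Environment I Ω S) (i : I) (σ τ : S) :
    E.posterior i σ τ = (E.posteriorFreq E.truth σ τ).toReal := by
  rw [posterior_eq]
  simp only [posteriorFreq, signalMass, jointFreq, reportFreq_truth]

theorem isCalibrated_truth (E : Environment I Ω S) : E.IsCalibrated E.truth := by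
  intro i σ hσ
  obtain ⟨q, hq⟩ := E.posteriorFreq_weight_eq E.truth hσ
  have h : E.posterior i σ = q.1 := funext fun τ => by
    rw [posterior_eq_posteriorFreq, ← hq, ENNReal.toReal_ofReal (q.2.1 τ)]
  have h' : E.truePrediction i σ = q := by
    have hmem : E.posterior i σ ∈ stdSimplex ℝ S := h ▸ q.2
    rw [truePrediction, dif_pos hmem]
    exact Subtype.ext h
  refine ae_of_all _ fun u τ => ?_
  change weight (E.truePrediction i σ) τ = _
  rw [h', hq]

theorem stateLoss_truth (E : Environment I Ω S) (i : I) :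
    E.stateLoss E.truth (E.truth.strategy i) = E.stateEntropy E.truth := by
  refine Finset.sum_congr rfl fun τ _ => lintegral_congr fun x => ?_
  rw [E.reportFreq_truth, ← E.reportProb_truth i]
  rfl

theorem peerLoss_truth (E : Environment I Ω S) (i : I) :
    E.peerLoss E.truth (E.truth.strategy i) = E.peerEntropy E.truth := by
  refine Finset.sum_congr rfl fun σ _ => Finset.sum_congr rfl fun τ _ => ?_
  congr 1
  refine lintegral_congr fun x => ?_
  rw [mul_comm, E.reportFreq_truth, ← E.reportProb_truth i (E.W x) τ]
  rfl

/-- A misreport does not improve the exchange of information with truthful agents. -/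
theorem peerLoss_add_stateEntropy_le (E : Environment I Ω S) (t : Strategy S) :
    E.peerLoss E.truth t + E.stateEntropy E.truth ≤
      E.peerEntropy E.truth + E.stateLoss E.truth t := by
  have h := E.garbling_le (A := fun ρ τ => volume {u | (t.toFun ρ u).1 = τ})
    (sum_volume_report t) (v := fun τ x => weight (E.W x) τ) (fun τ => E.measurable_weight τ)
    fun τ x => weight_le_one _ τ
  have e1 : E.peerLoss E.truth t = ∑ σ, ∑ τ,
      (∫⁻ x, weight (E.W x) σ *
        ∑ ρ, weight (E.W x) ρ * volume {u | (t.toFun ρ u).1 = τ} ∂E.P) *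
        nlog ((E.signalMass σ)⁻¹ * ∫⁻ x, weight (E.W x) σ * weight (E.W x) τ ∂E.P) := by
    simp only [peerLoss, posteriorFreq, jointFreq, reportFreq_truth]
    refine Finset.sum_congr rfl fun σ _ => Finset.sum_congr rfl fun τ _ => ?_
    congr 1
    exact lintegral_congr fun x => mul_comm _ _
  have e2 : E.stateLoss E.truth t = ∑ τ, ∫⁻ x,
      (∑ ρ, weight (E.W x) ρ * volume {u | (t.toFun ρ u).1 = τ}) *
        nlog (weight (E.W x) τ) ∂E.P := by
    simp only [stateLoss, reportFreq_truth]
    rfl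
  rw [e1, e2]
  exact h

/-- A report that a reference agent deems impossible is impossible given her signal, and the
information score is then `-∞`. -/
theorem emean_scoreIm_truth_eq_bot (E : Environment I Ω S) {i j : I} (hij : j ≠ i)
    (t : Strategy S) (h : E.peerLoss E.truth t = ⊤) :
    (emean E.P fun x => scoreIm (E.reportDist E.truth x) (E.report t i x)
      (E.report (E.truth.strategy j) j x)) = ⊥ := by
  obtain ⟨σ, -, h⟩ := ENNReal.sum_eq_top.1 h
  obtain ⟨τ, -, h⟩ := ENNReal.sum_eq_top.1 h
  have hle : ∫⁻ x, t.prob τ (E.W x) * weight (E.W x) σ ∂E.P ≤ 1 :=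
    (lintegral_mono fun x => mul_le_one' (prob_le_one t τ (E.W x)) (weight_le_one _ σ)).trans
      (by simp)
  obtain ⟨h0, htop⟩ | ⟨htop, -⟩ := ENNReal.mul_eq_top.1 h
  swap
  · exact absurd htop (ne_top_of_le_ne_top ENNReal.one_ne_top hle)
  have hq : E.posteriorFreq E.truth σ τ = 0 := by
    by_contra hne
    exact nlog_ne_top hne htop
  have hj : ∫⁻ x, weight (E.W x) σ * weight (E.W x) τ ∂E.P = 0 := by
    rw [posteriorFreq, mul_eq_zero] at hq
    simpa only [jointFreq, reportFreq_truth] using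
      hq.resolve_left (ENNReal.inv_ne_zero.2 (E.signalMass_ne_top σ))
  set T : Set Ω := {x | E.Ψ j x = σ} ∩ {x | (E.report t i x).1 = τ} with hT
  have hTm : MeasurableSet T :=
    (E.measurable_Ψ j (measurableSet_singleton σ)).inter
      (E.measurableSet_report (Profile.const t) i τ)
  have hT0 : E.P T ≠ 0 := by
    have h1 := E.atom_report_law (Profile.const t) hij σ τ MeasurableSet.univ MeasurableSet.univ
    simp only [preimage_univ, univ_inter, mem_univ, and_true, measure_univ, mul_one,
      setLIntegral_univ] at h1
    have h2 : E.P T = ∫⁻ x, t.prob τ (E.W x) * weight (E.W x) σ ∂E.P :=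
      h1.trans (lintegral_congr fun x => mul_comm _ _)
    rwa [h2]
  have hB : MeasurableSet {w : Simplex S | weight w τ ≠ 0} :=
    (measurable_coord τ) (measurableSet_singleton (0 : ℝ≥0∞)).compl
  have hnull : E.P (E.W ⁻¹' {w | weight w τ ≠ 0} ∩ {x | E.Ψ j x = σ}) = 0 := by
    have h1 := E.single_law j σ MeasurableSet.univ hB
    simp only [mem_univ, and_true, measure_univ, mul_one] at h1
    rw [h1]
    rw [lintegral_eq_zero_iff (by fun_prop)] at hj
    rw [setLIntegral_eq_zero_iff (E.measurable_W hB) (E.measurable_weight σ)]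
    exact hj.mono fun x hx hxB => (mul_eq_zero.1 hx).resolve_right hxB
  refine emean_eq_bot hTm hT0 ?_
  filter_upwards [E.reportDist_truth, measure_eq_zero_iff_ae_notMem.1 hnull] with x hx hxn hxT
  have hw : weight (E.W x) τ = 0 := by
    by_contra hne
    exact hxn ⟨hne, hxT.1⟩
  have hr : (E.report t i x).1 = τ := hxT.2
  rw [scoreIm_eq, hx, hr, hw, nlog_zero, EReal.coe_ennreal_top, EReal.sub_top]

theorem informationScore_truth_le (E : Environment I Ω S) (i : I) (t : Strategy S) :
    E.informationScore E.truth i t ≤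
      (E.peerEntropy E.truth : EReal) - (E.stateEntropy E.truth : EReal) := by
  by_cases h : E.peerLoss E.truth t = ⊤
  · have : E.informationScore E.truth i t = ⊥ :=
      emean_eq_const ((E.ae_ne i).mono fun _ hj => E.emean_scoreIm_truth_eq_bot hj t h)
    rw [this]
    exact bot_le
  · rw [E.isCalibrated_truth.informationScore_eq i t (Or.inl h)]
    have hle := E.peerLoss_add_stateEntropy_le t
    have hH := E.stateEntropy_ne_top E.truth
    have hC := E.peerEntropy_ne_top E.truth
    generalize E.peerLoss E.truth t = a at *
    generalize E.stateLoss E.truth t = b at *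
    generalize E.stateEntropy E.truth = H at *
    generalize E.peerEntropy E.truth = C at *
    lift H to NNReal using hH
    lift C to NNReal using hC
    lift a to NNReal using h
    rcases eq_or_ne b ⊤ with rfl | hb
    · simp [EReal.sub_top]
    lift b to NNReal using hb
    have hle' : (a : ℝ) + H ≤ C + b := by exact_mod_cast hle
    simp only [EReal.coe_nnreal_eq_coe_real, ← EReal.coe_sub, EReal.coe_le_coe_iff]
    linarith

theorem informationScore_truth (E : Environment I Ω S) (i : I) :
    E.informationScore E.truth i (E.truth.strategy i) =
      (E.peerEntropy E.truth : EReal) - (E.stateEntropy E.truth : EReal) := by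
  rw [E.isCalibrated_truth.informationScore_eq i _
    (Or.inr (by rw [stateLoss_truth]; exact E.stateEntropy_ne_top _)), peerLoss_truth,
    stateLoss_truth]

theorem IsCalibrated.predictionScore_eq {E : Environment I Ω S} {s : Profile I S}
    (hs : E.IsCalibrated s) (i : I) :
    E.predictionScore s i (s.strategy i) =
      (E.stateEntropy s : EReal) - (E.peerEntropy s : EReal) := by
  rw [Environment.predictionScore_eq, E.predictionLoss_of_calibrated s (s.strategy i) (hs i)]

theorem predictionScore_truth_le (E : Environment I Ω S) (i : I) (t : Strategy S) :
    E.predictionScore E.truth i t ≤ E.predictionScore E.truth i (E.truth.strategy i) := by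
  rw [E.isCalibrated_truth.predictionScore_eq, predictionScore_eq]
  exact EReal.sub_le_sub le_rfl
    (EReal.coe_ennreal_le_coe_ennreal_iff.2 (E.peerEntropy_le_predictionLoss E.truth t))

/-- Truth-telling is an equilibrium: the truth maximizes both parts of the payment separately. -/
theorem isEquilibrium_truth (E : Environment I Ω S) {α : ℝ} (hα : 0 ≤ α) :
    E.IsEquilibrium α E.truth := by
  refine fun i => ⟨?_, fun t => ?_⟩
  · rw [payment, informationScore_truth, E.isCalibrated_truth.predictionScore_eq]
    have hH := E.stateEntropy_ne_top E.truth
    have hC := E.peerEntropy_ne_top E.truth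
    generalize E.stateEntropy E.truth = H at *
    generalize E.peerEntropy E.truth = C at *
    lift H to NNReal using hH
    lift C to NNReal using hC
    simp only [EReal.coe_nnreal_eq_coe_real, ← EReal.coe_sub, ← EReal.coe_mul, ← EReal.coe_add]
    exact ⟨EReal.coe_ne_bot _, EReal.coe_ne_top _⟩
  · refine add_le_add (E.predictionScore_truth_le i t) ?_
    refine mul_le_mul_of_nonneg_left ?_ (EReal.coe_nonneg.2 hα)
    rw [informationScore_truth]
    exact E.informationScore_truth_le i t

/-! ### Averages over the agents -/

theorem IsCalibrated.ae_informationScore {E : Environment I Ω S} {s : Profile I S}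
    (hs : E.IsCalibrated s) :
    ∀ᵐ i ∂E.pop, E.informationScore s i (s.strategy i) =
      (E.peerLoss s (s.strategy i) : EReal) - (E.stateLoss s (s.strategy i) : EReal) := by
  have hfin : ∀ᵐ j ∂E.pop, E.stateLoss s (s.strategy j) < ⊤ :=
    ae_lt_top (E.measurable_stateLoss s) (by
      rw [E.lintegral_stateLoss]; exact E.stateEntropy_ne_top s)
  exact hfin.mono fun i hi => hs.informationScore_eq i _ (Or.inr hi.ne)

theorem IsCalibrated.avgInformationScore_eq {E : Environment I Ω S} {s : Profile I S}
    (hs : E.IsCalibrated s) :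
    E.avgInformationScore s = (E.peerEntropy s : EReal) - (E.stateEntropy s : EReal) := by
  rw [avgInformationScore, emean_congr_ae hs.ae_informationScore,
    emean_coe_sub (E.measurable_peerLoss s).aemeasurable (E.measurable_stateLoss s).aemeasurable
      (Or.inr (by rw [E.lintegral_stateLoss]; exact E.stateEntropy_ne_top s)),
    E.lintegral_peerLoss, E.lintegral_stateLoss]

theorem IsCalibrated.avgPredictionScore_eq {E : Environment I Ω S} {s : Profile I S}
    (hs : E.IsCalibrated s) :
    E.avgPredictionScore s = (E.stateEntropy s : EReal) - (E.peerEntropy s : EReal) := by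
  simp only [avgPredictionScore, hs.predictionScore_eq, emean_const]

/-- In a calibrated profile each agent gets `α` times her information score minus the common value
`peerEntropy - stateEntropy`. -/
theorem IsCalibrated.welfare_eq {E : Environment I Ω S} {s : Profile I S}
    (hs : E.IsCalibrated s) {α : ℝ} (hα : 0 ≤ α) :
    E.welfare α s =
      (((α - 1) * ((E.peerEntropy s).toReal - (E.stateEntropy s).toReal) : ℝ) : EReal) := by
  have hH := E.stateEntropy_ne_top s
  have hC := E.peerEntropy_ne_top s
  set a : ℝ≥0∞ := ENNReal.ofReal α with ha
  set P : I → ℝ≥0∞ := fun i => a * E.peerLoss s (s.strategy i) + E.stateEntropy s with hP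
  set N : I → ℝ≥0∞ := fun i => a * E.stateLoss s (s.strategy i) + E.peerEntropy s with hN
  have hPm : Measurable P := ((E.measurable_peerLoss s).const_mul a).add_const _
  have hNm : Measurable N := ((E.measurable_stateLoss s).const_mul a).add_const _
  have hPi : ∫⁻ i, P i ∂E.pop = a * E.peerEntropy s + E.stateEntropy s := by
    rw [hP, lintegral_add_right _ measurable_const, lintegral_const_mul _ (E.measurable_peerLoss s),
      E.lintegral_peerLoss, lintegral_const, measure_univ, mul_one]
  have hNi : ∫⁻ i, N i ∂E.pop = a * E.stateEntropy s + E.peerEntropy s := by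
    rw [hN, lintegral_add_right _ measurable_const,
      lintegral_const_mul _ (E.measurable_stateLoss s),
      E.lintegral_stateLoss, lintegral_const, measure_univ, mul_one]
  have hfin : ∀ᵐ i ∂E.pop, E.stateLoss s (s.strategy i) < ⊤ :=
    ae_lt_top (E.measurable_stateLoss s) (by rw [E.lintegral_stateLoss]; exact hH)
  have hfin' : ∀ᵐ i ∂E.pop, E.peerLoss s (s.strategy i) < ⊤ :=
    ae_lt_top (E.measurable_peerLoss s) (by rw [E.lintegral_peerLoss]; exact hC)
  have hae : (fun i => E.payment α s i (s.strategy i)) =ᵐ[E.pop]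
      fun i => (P i : EReal) - (N i : EReal) := by
    filter_upwards [hs.ae_informationScore, hfin, hfin'] with i hi h1 h2
    rw [payment, hi, hs.predictionScore_eq, hP, hN, ha]
    beta_reduce
    generalize E.stateEntropy s = H at *
    generalize E.peerEntropy s = C at *
    generalize E.peerLoss s (s.strategy i) = p at *
    generalize E.stateLoss s (s.strategy i) = n at *
    lift H to NNReal using hH
    lift C to NNReal using hC
    lift p to NNReal using h2.ne
    lift n to NNReal using h1.ne
    lift α to NNReal using hα
    rw [ENNReal.ofReal_coe_nnreal, ← ENNReal.coe_mul, ← ENNReal.coe_add, ← ENNReal.coe_mul,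
      ← ENNReal.coe_add]
    simp only [EReal.coe_nnreal_eq_coe_real, ← EReal.coe_sub, ← EReal.coe_mul, ← EReal.coe_add,
      EReal.coe_eq_coe_iff, NNReal.coe_add, NNReal.coe_mul]
    ring
  have hfinP : a * E.peerEntropy s + E.stateEntropy s ≠ ⊤ :=
    ENNReal.add_ne_top.2 ⟨ENNReal.mul_ne_top ENNReal.ofReal_ne_top hC, hH⟩
  rw [welfare, emean_congr_ae hae, emean_coe_sub hPm.aemeasurable hNm.aemeasurable
    (Or.inl (by rwa [hPi])), hPi, hNi, ha]
  generalize E.stateEntropy s = H at *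
  generalize E.peerEntropy s = C at *
  lift H to NNReal using hH
  lift C to NNReal using hC
  lift α to NNReal using hα
  rw [ENNReal.ofReal_coe_nnreal, ← ENNReal.coe_mul, ← ENNReal.coe_add, ← ENNReal.coe_mul,
    ← ENNReal.coe_add]
  simp only [EReal.coe_nnreal_eq_coe_real, ← EReal.coe_sub, ENNReal.coe_toReal,
    EReal.coe_eq_coe_iff, NNReal.coe_add, NNReal.coe_mul]
  ring

end Environment
end BTS

/-! ### Mutual information with a finite random variable -/

section mutualInfo

variable {X S : Type*} [MeasurableSpace X] [Fintype S] [MeasurableSpace S]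
  [MeasurableSingletonClass S]

theorem measure_eq_sum_prod_singleton (ν : Measure (X × S)) {A : Set (X × S)}
    (hA : MeasurableSet A) : ν A = ∑ τ, ν (((fun x => (x, τ)) ⁻¹' A) ×ˢ {τ}) := by
  have hU : A = ⋃ τ, ((fun x => (x, τ)) ⁻¹' A) ×ˢ {τ} := by
    ext ⟨x, τ⟩
    simp
  conv_lhs => rw [hU]
  rw [measure_iUnion, tsum_fintype]
  · intro τ τ' h
    refine Set.disjoint_left.2 fun p hp hp' => h ?_
    exact hp.2.symm.trans hp'.2
  · exact fun τ => (measurable_prodMk_right hA).prod (measurableSet_singleton τ)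

/-- The mutual information of `x` and `τ` is the entropy of `τ` minus its conditional entropy, when
`τ` has the conditional distribution `v · x` given `x`. -/
theorem mutualInfo_add_entropy {η : Measure X} [IsProbabilityMeasure η] {v : S → X → ℝ≥0∞}
    (hv : ∀ τ, Measurable (v τ)) (hsum : ∀ x, ∑ τ, v τ x = 1) {ν : Measure (X × S)}
    (hν : ∀ τ B, MeasurableSet B → ν (B ×ˢ {τ}) = ∫⁻ x in B, v τ x ∂η) :
    mutualInfo ν + ∑ τ, ∫⁻ x, v τ x * BTS.nlog (v τ x) ∂η =
      ∑ τ, (∫⁻ x, v τ x ∂η) * BTS.nlog (∫⁻ x, v τ x ∂η) := by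
  have hv1 : ∀ τ x, v τ x ≤ 1 := fun τ x => by
    rw [← hsum x]
    exact Finset.single_le_sum (f := fun τ => v τ x) (fun _ _ => zero_le) (Finset.mem_univ τ)
  set q : S → ℝ≥0∞ := fun τ => ∫⁻ x, v τ x ∂η with hq
  have hq1 : ∀ τ, q τ ≤ 1 := fun τ => (lintegral_mono (hv1 τ)).trans (by simp)
  have hqt : ∀ τ, q τ ≠ ⊤ := fun τ => ne_top_of_le_ne_top ENNReal.one_ne_top (hq1 τ)
  have hfst : ν.fst = η := by
    ext B hB
    rw [Measure.fst_apply hB, measure_eq_sum_prod_singleton ν (measurable_fst hB)]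
    have e : ∀ τ : S, (fun x => (x, τ)) ⁻¹' (Prod.fst ⁻¹' B) = B := fun τ => rfl
    simp only [e, fun τ => hν τ B hB]
    rw [← lintegral_finsetSum _ fun τ _ => hv τ]
    simp [hsum]
  have hsnd : ∀ τ, ν.snd {τ} = q τ := fun τ => by
    rw [Measure.snd_apply (measurableSet_singleton τ), ← univ_prod, hν τ _ MeasurableSet.univ,
      setLIntegral_univ]
  have : IsProbabilityMeasure ν := ⟨by
    rw [← Measure.fst_univ, hfst, measure_univ]⟩
  have hvq : ∀ τ, Measurable fun x => v τ x / q τ := fun τ => (hv τ).div_const (q τ)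
  set d : X × S → ℝ≥0∞ := fun p => v p.2 p.1 / q p.2 with hd
  have hdm : Measurable d := measurable_from_prod_countable_left fun τ => hvq τ
  have hint : ∀ f : X × S → ℝ≥0∞, Measurable f →
      ∫⁻ p, f p ∂(η.prod ν.snd) = ∑ τ, q τ * ∫⁻ x, f (x, τ) ∂η := fun f hf => by
    rw [lintegral_prod_symm _ hf.aemeasurable, lintegral_fintype]
    exact Finset.sum_congr rfl fun τ _ => by rw [hsnd, mul_comm]
  have hzero : ∀ τ, q τ = 0 → v τ =ᵐ[η] 0 := fun τ h => (lintegral_eq_zero_iff (hv τ)).1 h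
  have hdens : ν = (η.prod ν.snd).withDensity d := by
    refine Measure.ext fun A hA => ?_
    rw [withDensity_apply _ hA, ← lintegral_indicator hA, hint _ (hdm.indicator hA),
      measure_eq_sum_prod_singleton ν hA]
    refine Finset.sum_congr rfl fun τ _ => ?_
    have hAτ : MeasurableSet ((fun x => (x, τ)) ⁻¹' A) := measurable_prodMk_right hA
    have e : ∀ x, A.indicator d (x, τ) =
        ((fun x => (x, τ)) ⁻¹' A).indicator (fun x => v τ x / q τ) x := fun x => by
      by_cases h : (x, τ) ∈ A
      · rw [indicator_of_mem h, indicator_of_mem (show x ∈ (fun x => (x, τ)) ⁻¹' A from h)]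
      · rw [indicator_of_notMem h, indicator_of_notMem (show x ∉ (fun x => (x, τ)) ⁻¹' A from h)]
    simp only [e]
    rw [lintegral_indicator hAτ, hν τ _ hAτ]
    simp only [div_eq_mul_inv]
    rw [lintegral_mul_const _ (hv τ)]
    by_cases h0 : q τ = 0
    · rw [h0, zero_mul]
      rw [lintegral_congr_ae (ae_restrict_of_ae (hzero τ h0))]
      simp
    · rw [mul_comm, mul_assoc, ENNReal.inv_mul_cancel h0 (hqt τ), mul_one]
  have hac : ν ≪ η.prod ν.snd := by
    conv_lhs => rw [hdens]
    exact withDensity_absolutelyContinuous _ _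
  have hrn : ν.rnDeriv (η.prod ν.snd) =ᵐ[η.prod ν.snd] d := by
    have h := Measure.rnDeriv_withDensity (η.prod ν.snd) hdm
    rwa [← hdens] at h
  have hkm : Measurable fun y : ℝ≥0∞ => ENNReal.ofReal (InformationTheory.klFun y.toReal) :=
    ENNReal.measurable_ofReal.comp
      (InformationTheory.measurable_klFun.comp ENNReal.measurable_toReal)
  have hkl : mutualInfo ν = ∑ τ, q τ *
      ∫⁻ x, ENNReal.ofReal (InformationTheory.klFun (v τ x / q τ).toReal) ∂η := by
    rw [mutualInfo, hfst, InformationTheory.klDiv_eq_lintegral_klFun_of_ac hac,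
      ← lintegral_congr_ae (hrn.symm.mono fun p hp =>
        congrArg (fun y : ℝ≥0∞ => ENNReal.ofReal (InformationTheory.klFun y.toReal)) hp)]
    exact hint _ (hkm.comp hdm)
  rw [hkl, ← Finset.sum_add_distrib]
  refine Finset.sum_congr rfl fun τ _ => ?_
  have hvn : Measurable fun x => v τ x * BTS.nlog (v τ x) :=
    (hv τ).mul (BTS.measurable_nlog.comp (hv τ))
  by_cases h0 : q τ = 0
  · have : ∫⁻ x, v τ x * BTS.nlog (v τ x) ∂η = 0 := by
      rw [lintegral_eq_zero_iff hvn]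
      exact (hzero τ h0).mono fun x hx => by simp [hx]
    rw [this]
    change q τ * _ + 0 = q τ * _
    simp [h0]
  · have hp := lintegral_congr (μ := η) fun x => BTS.klFun_add_nlog (hv1 τ x) (hq1 τ) h0
    have hkτ : Measurable fun x =>
        ENNReal.ofReal (InformationTheory.klFun (v τ x / q τ).toReal) :=
      hkm.comp (hvq τ)
    rw [lintegral_add_right _ (show Measurable fun x => v τ x * BTS.nlog (v τ x) + v τ x from
      hvn.add (hv τ)), lintegral_const_mul _ hkτ,
      lintegral_add_right _ (hv τ), lintegral_add_right _ measurable_const,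
      lintegral_mul_const _ (hv τ), lintegral_const, measure_univ, mul_one, ← add_assoc] at hp
    exact (ENNReal.add_left_inj (hqt τ)).1 hp

end mutualInfo

namespace BTS
namespace Environment

variable {I Ω S : Type*} [MeasurableSpace I] [MeasurableSpace Ω] [Fintype S] [MeasurableSpace S]
  [MeasurableSingletonClass S]

/-- The conditional mutual information of a random distribution `V` and a signal drawn from it,
given the private signal of another agent, is a difference of conditional entropies. -/
theorem condMutualInfo_add_entropy (E : Environment I Ω S) {V : Ω → Simplex S}
    (hV : Measurable V) {m : Measure (Simplex S × S × S)}
    (hm : ∀ σ τ B, MeasurableSet B → m (B ×ˢ {τ} ×ˢ {σ}) =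
      ∫⁻ x in V ⁻¹' B, weight (E.W x) σ * weight (V x) τ ∂E.P) :
    condMutualInfo m + ∑ τ, ∫⁻ x, weight (V x) τ * nlog (weight (V x) τ) ∂E.P =
      ∑ σ, ∑ τ, (∫⁻ x, weight (E.W x) σ * weight (V x) τ ∂E.P) *
        nlog ((E.signalMass σ)⁻¹ * ∫⁻ x, weight (E.W x) σ * weight (V x) τ ∂E.P) := by
  have hVm : ∀ τ, Measurable fun x => weight (V x) τ := fun τ => (measurable_coord τ).comp hV
  have hVn : ∀ τ, Measurable fun x => weight (V x) τ * nlog (weight (V x) τ) := fun τ =>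
    (hVm τ).mul (measurable_nlog.comp (hVm τ))
  have hterm : ∀ σ, m {p | p.2.2 = σ} *
      mutualInfo ((m[|{p | p.2.2 = σ}]).map fun p => (p.1, p.2.1)) +
      ∑ τ, ∫⁻ x, weight (E.W x) σ * (weight (V x) τ * nlog (weight (V x) τ)) ∂E.P =
      ∑ τ, (∫⁻ x, weight (E.W x) σ * weight (V x) τ ∂E.P) *
        nlog ((E.signalMass σ)⁻¹ * ∫⁻ x, weight (E.W x) σ * weight (V x) τ ∂E.P) := fun σ => by
    have hZ : MeasurableSet {p : Simplex S × S × S | p.2.2 = σ} :=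
      (measurable_snd.comp measurable_snd) (measurableSet_singleton σ)
    have hmap : Measurable fun p : Simplex S × S × S => (p.1, p.2.1) := by fun_prop
    have hrect : ∀ (B : Set (Simplex S)) (τ : S),
        {p : Simplex S × S × S | p.2.2 = σ} ∩ (fun p => (p.1, p.2.1)) ⁻¹' (B ×ˢ {τ}) =
          B ×ˢ {τ} ×ˢ {σ} := fun B τ => by
      ext p
      simp only [mem_inter_iff, mem_ofPred_eq, mem_preimage, mem_prod, mem_singleton_iff]
      tauto
    have hmass : m {p | p.2.2 = σ} = E.signalMass σ := by
      have h := measure_eq_sum_prod_singleton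
        ((m.restrict {p | p.2.2 = σ}).map fun p => (p.1, p.2.1)) MeasurableSet.univ
      rw [Measure.map_apply hmap MeasurableSet.univ, preimage_univ, Measure.restrict_apply_univ] at h
      rw [h, signalMass]
      have e : ∀ τ, ((m.restrict {p | p.2.2 = σ}).map fun p => (p.1, p.2.1))
          (((fun x => (x, τ)) ⁻¹' univ) ×ˢ {τ}) =
          ∫⁻ x, weight (E.W x) σ * weight (V x) τ ∂E.P := fun τ => by
        rw [preimage_univ, Measure.map_apply hmap
          (MeasurableSet.univ.prod (measurableSet_singleton τ)), Measure.restrict_apply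
          (hmap (MeasurableSet.univ.prod (measurableSet_singleton τ))), inter_comm, hrect,
          hm σ τ _ MeasurableSet.univ, preimage_univ, setLIntegral_univ]
      simp only [e]
      rw [← lintegral_finsetSum _ fun τ _ => by
        exact (E.measurable_weight σ).mul (hVm τ)]
      simp only [← Finset.mul_sum, sum_coord, mul_one]
    have hMt := E.signalMass_ne_top σ
    rw [hmass]
    by_cases h0 : E.signalMass σ = 0
    · have hw : (fun x => weight (E.W x) σ) =ᵐ[E.P] 0 :=
        (lintegral_eq_zero_iff (E.measurable_weight σ)).1 h0
      have hz : ∀ f : Ω → ℝ≥0∞, ∫⁻ x, weight (E.W x) σ * f x ∂E.P = 0 := fun f => by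
        rw [lintegral_congr_ae (g := fun _ => 0) (hw.mono fun x hx => by
          change weight (E.W x) σ = 0 at hx
          simp only [hx, zero_mul])]
        simp
      simp [hz, h0]
    set M := E.signalMass σ with hM
    set η : Measure (Simplex S) := M⁻¹ • (E.P.withDensity fun x => weight (E.W x) σ).map V
      with hη
    have hηint : ∀ f : Simplex S → ℝ≥0∞, Measurable f →
        ∫⁻ w, f w ∂η = M⁻¹ * ∫⁻ x, weight (E.W x) σ * f (V x) ∂E.P := fun f hf => by
      rw [hη, lintegral_smul_measure, lintegral_map hf hV, smul_eq_mul,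
        lintegral_withDensity_eq_lintegral_mul _ (E.measurable_weight σ)
          (g := fun x => f (V x)) (hf.comp hV)]
      rfl
    have : IsProbabilityMeasure η := ⟨by
      rw [← setLIntegral_one, setLIntegral_univ, hηint _ measurable_const]
      simp only [mul_one]
      exact ENNReal.inv_mul_cancel h0 hMt⟩
    have key := mutualInfo_add_entropy (η := η) (v := fun τ w => weight w τ)
      (ν := (m[|{p | p.2.2 = σ}]).map fun p => (p.1, p.2.1)) measurable_coord sum_coord
      fun τ B hB => by
        rw [Measure.map_apply hmap (hB.prod (measurableSet_singleton τ)), cond_apply hZ, hrect,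
          hm σ τ B hB, hmass, ← lintegral_indicator hB, hηint _ ((measurable_coord τ).indicator hB),
          ← lintegral_indicator (hV hB)]
        congr 1
        refine lintegral_congr fun x => ?_
        by_cases hx : V x ∈ B
        · rw [indicator_of_mem (show x ∈ V ⁻¹' B from hx), indicator_of_mem hx]
        · rw [indicator_of_notMem (show x ∉ V ⁻¹' B from hx), indicator_of_notMem hx, mul_zero]
    have hn : ∀ τ, Measurable fun w : Simplex S => weight w τ * nlog (weight w τ) := fun τ =>
      (measurable_coord τ).mul (measurable_nlog.comp (measurable_coord τ))
    simp only [fun τ => hηint _ (measurable_coord τ), fun τ => hηint _ (hn τ)] at key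
    have key' := congrArg (M * ·) key
    simp only [mul_add, Finset.mul_sum, ← mul_assoc, ENNReal.mul_inv_cancel h0 hMt, one_mul]
      at key'
    simpa only [mul_assoc] using key'
  have hs := Finset.sum_congr rfl fun σ (_ : σ ∈ (Finset.univ : Finset S)) => hterm σ
  rw [Finset.sum_add_distrib, Finset.sum_comm (f := fun σ τ => ∫⁻ x, weight (E.W x) σ *
    (weight (V x) τ * nlog (weight (V x) τ)) ∂E.P),
    Finset.sum_congr rfl fun τ _ => E.sum_lintegral_weight_mul (hVn τ)] at hs
  exact hs

theorem infoTruth_add_stateEntropy (E : Environment I Ω S) {i j : I} (hij : i ≠ j) :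
    E.infoTruth i j + E.stateEntropy E.truth = E.peerEntropy E.truth := by
  have hmeas : Measurable fun x => (E.W x, E.Ψ i x, E.Ψ j x) :=
    E.measurable_W.prodMk ((E.measurable_Ψ i).prodMk (E.measurable_Ψ j))
  have h := E.condMutualInfo_add_entropy E.measurable_W
    (m := E.P.map fun x => (E.W x, E.Ψ i x, E.Ψ j x)) fun σ τ B hB => by
      rw [Measure.map_apply hmeas (hB.prod ((measurableSet_singleton τ).prod
        (measurableSet_singleton σ)))]
      have h1 := E.atom_report_law E.truth hij.symm σ τ MeasurableSet.univ hB
      simp only [mem_univ, and_true, measure_univ, mul_one, reportProb_truth] at h1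
      rw [← h1]
      congr 1
      ext x
      simp only [mem_inter_iff, mem_ofPred_eq, mem_preimage, mem_prod, mem_singleton_iff]
      change _ ↔ (E.W x ∈ B ∧ E.Ψ j x = σ) ∧ E.Ψ i x = τ
      tauto
  simp only [infoTruth, stateEntropy, peerEntropy, posteriorFreq, jointFreq, reportFreq_truth]
  exact h

/-- The distribution of reports in the state `w`. -/
noncomputable def reportSimplex (E : Environment I Ω S) (s : Profile I S) (w : Simplex S) :
    Simplex S :=
  ⟨fun τ => (E.reportFreq s w τ).toReal, fun _ => ENNReal.toReal_nonneg, by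
    rw [← ENNReal.toReal_sum fun τ _ =>
      ne_top_of_le_ne_top ENNReal.one_ne_top (E.reportFreq_le_one s w τ), E.sum_reportFreq,
      ENNReal.toReal_one]⟩

theorem measurable_reportSimplex (E : Environment I Ω S) (s : Profile I S) :
    Measurable (E.reportSimplex s) :=
  Measurable.subtype_mk (measurable_pi_lambda _ fun τ =>
    (E.measurable_reportFreq s τ).ennreal_toReal)

theorem reportDist_eq (E : Environment I Ω S) (s : Profile I S) :
    ∀ᵐ x ∂E.P, E.reportDist s x = E.reportSimplex s (E.W x) := by
  filter_upwards [E.weight_reportDist s] with x hx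
  refine Subtype.ext (funext fun τ => ?_)
  change _ = (E.reportFreq s (E.W x) τ).toReal
  rw [← hx τ, ENNReal.toReal_ofReal ((E.reportDist s x).2.1 τ)]

theorem measurable_reportDist (E : Environment I Ω S) (s : Profile I S) :
    Measurable (E.reportDist s) :=
  (E.exists_isReportDistribution s).choose_spec.measurable

theorem setLIntegral_signal (E : Environment I Ω S) (j : I) (σ : S) {h : Simplex S → ℝ≥0∞}
    (hh : Measurable h) :
    ∫⁻ x in {x | E.Ψ j x = σ}, h (E.W x) ∂E.P = ∫⁻ x, weight (E.W x) σ * h (E.W x) ∂E.P := by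
  have h1 := E.report_lintegral E.truth j σ hh
  simp only [reportProb_truth] at h1
  exact h1

/-- The joint law of the distribution of reports, the report of agent `k` and the signal of agent
`j` is a measurable function of `k` off a null set that contains `j`. -/
theorem aemeasurable_report_law (E : Environment I Ω S) (s : Profile I S) (j : I) :
    AEMeasurable (fun k => E.P.map fun x =>
      (E.reportDist s x, (E.report (s.strategy k) k x).1, E.Ψ j x)) E.pop := by
  classical
  have hmeas : ∀ k, Measurable fun x =>
      (E.reportDist s x, (E.report (s.strategy k) k x).1, E.Ψ j x) := fun k =>
    (E.measurable_reportDist s).prodMk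
      ((E.measurable_reported_signal (s.strategy k) k).prodMk (E.measurable_Ψ j))
  set N := toMeasurable E.pop {j} with hN
  have hNm : MeasurableSet N := measurableSet_toMeasurable _ _
  have hN0 : E.pop N = 0 := by rw [hN, measure_toMeasurable, measure_singleton]
  have hjN : j ∈ N := subset_toMeasurable _ _ rfl
  refine ⟨fun k => if k ∈ N then 0 else E.P.map fun x =>
    (E.reportDist s x, (E.report (s.strategy k) k x).1, E.Ψ j x), ?_, ?_⟩
  · refine Measure.measurable_of_measurable_coe _ fun A hA => ?_
    have hind : ∀ σ τ, Measurable fun w : Simplex S =>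
        A.indicator (1 : Simplex S × S × S → ℝ≥0∞) (E.reportSimplex s w, τ, σ) := fun σ τ =>
      (measurable_one.indicator hA).comp
        ((E.measurable_reportSimplex s).prodMk measurable_const)
    have hval : ∀ k, k ∉ N → (E.P.map fun x =>
        (E.reportDist s x, (E.report (s.strategy k) k x).1, E.Ψ j x)) A =
        ∑ σ, ∑ τ, ∫⁻ x, reportProb s k τ (E.W x) * (weight (E.W x) σ *
          A.indicator 1 (E.reportSimplex s (E.W x), τ, σ)) ∂E.P := fun k hk => by
      have hjk : j ≠ k := fun h => hk (h ▸ hjN)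
      rw [← lintegral_indicator_one hA, lintegral_map (measurable_one.indicator hA) (hmeas k)]
      refine Eq.trans (lintegral_congr_ae ((E.reportDist_eq s).mono fun x hx => ?_))
        ((E.lintegral_report_pair s hjk (F := fun τ σ w _ =>
          A.indicator 1 (E.reportSimplex s w, τ, σ))
          fun τ σ => (hind σ τ).comp measurable_fst).trans ?_)
      · simp only [hx]
      · refine Finset.sum_congr rfl fun σ _ => Finset.sum_congr rfl fun τ _ =>
          lintegral_congr fun x => ?_
        rw [lintegral_const, measure_univ, mul_one]
        ring
    have heq : (fun k => (if k ∈ N then (0 : Measure (Simplex S × S × S)) else E.P.map fun x =>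
        (E.reportDist s x, (E.report (s.strategy k) k x).1, E.Ψ j x)) A) =
        fun k => if k ∈ N then 0 else ∑ σ, ∑ τ, ∫⁻ x, reportProb s k τ (E.W x) *
          (weight (E.W x) σ * A.indicator 1 (E.reportSimplex s (E.W x), τ, σ)) ∂E.P := by
      funext k
      split_ifs with hk
      · simp
      · exact hval k hk
    rw [heq]
    refine Measurable.ite hNm measurable_const ?_
    exact Finset.measurable_sum _ fun σ _ => Finset.measurable_sum _ fun τ _ =>
      E.measurable_lintegral_reportProb_mul s τ
        ((E.measurable_weight σ).mul ((hind σ τ).comp E.measurable_W))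
  · filter_upwards [measure_eq_zero_iff_ae_notMem.1 hN0] with k hk
    rw [if_neg hk]

theorem infoReport_add_stateEntropy (E : Environment I Ω S) (s : Profile I S) (j : I) :
    E.infoReport s j + E.stateEntropy s = E.peerEntropy s := by
  have hD := E.measurable_reportDist s
  have hw := E.weight_reportDist s
  have h := E.condMutualInfo_add_entropy hD (m := E.pop.bind fun k => E.P.map fun x =>
      (E.reportDist s x, (E.report (s.strategy k) k x).1, E.Ψ j x)) fun σ τ B hB => by
    have hR : MeasurableSet (B ×ˢ ({τ} : Set S) ×ˢ ({σ} : Set S)) :=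
      hB.prod ((measurableSet_singleton τ).prod (measurableSet_singleton σ))
    have hA : MeasurableSet (E.reportDist s ⁻¹' B ∩ {x | E.Ψ j x = σ}) :=
      (hD hB).inter (E.measurable_Ψ j (measurableSet_singleton σ))
    rw [Measure.bind_apply hR (E.aemeasurable_report_law s j)]
    have e : ∀ k, (E.P.map fun x =>
        (E.reportDist s x, (E.report (s.strategy k) k x).1, E.Ψ j x))
          (B ×ˢ ({τ} : Set S) ×ˢ ({σ} : Set S)) =
        E.P ((E.reportDist s ⁻¹' B ∩ {x | E.Ψ j x = σ}) ∩
          {x | (E.report (s.strategy k) k x).1 = τ}) := fun k => by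
      rw [Measure.map_apply (hD.prodMk ((E.measurable_reported_signal (s.strategy k) k).prodMk
        (E.measurable_Ψ j))) hR]
      congr 1
      ext x
      simp only [mem_inter_iff, mem_ofPred_eq, mem_preimage, mem_prod, mem_singleton_iff]
      tauto
    simp only [e]
    rw [E.lintegral_report_event s τ hA, ← lintegral_indicator (hD hB),
      ← setLIntegral_indicator (hD hB)]
    have hm : Measurable fun w => B.indicator (fun w => weight w τ) (E.reportSimplex s w) :=
      ((measurable_coord τ).indicator hB).comp (E.measurable_reportSimplex s)
    refine Eq.trans (lintegral_congr_ae (ae_restrict_of_ae ?_))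
      ((E.setLIntegral_signal j σ hm).trans (lintegral_congr_ae ?_))
    · filter_upwards [hw, E.reportDist_eq s] with x h1 h2
      rw [← h2]
      by_cases hx : E.reportDist s x ∈ B
      · rw [indicator_of_mem (show x ∈ E.reportDist s ⁻¹' B from hx), indicator_of_mem hx, h1]
      · rw [indicator_of_notMem (show x ∉ E.reportDist s ⁻¹' B from hx), indicator_of_notMem hx]
    · filter_upwards [E.reportDist_eq s] with x h2
      rw [← h2]
      by_cases hx : E.reportDist s x ∈ B
      · rw [indicator_of_mem (show x ∈ E.reportDist s ⁻¹' B from hx), indicator_of_mem hx]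
      · rw [indicator_of_notMem (show x ∉ E.reportDist s ⁻¹' B from hx), indicator_of_notMem hx,
          mul_zero]
  have e1 : ∀ τ, ∫⁻ x, weight (E.reportDist s x) τ * nlog (weight (E.reportDist s x) τ) ∂E.P =
      ∫⁻ x, E.reportFreq s (E.W x) τ * nlog (E.reportFreq s (E.W x) τ) ∂E.P := fun τ =>
    lintegral_congr_ae (hw.mono fun x hx => by simp only [hx τ])
  have e2 : ∀ σ τ, ∫⁻ x, weight (E.W x) σ * weight (E.reportDist s x) τ ∂E.P =
      E.jointFreq s σ τ := fun σ τ =>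
    lintegral_congr_ae (hw.mono fun x hx => by simp only [hx τ])
  simp only [e1, e2] at h
  exact h

end Environment
end BTS

/-- The information-theoretic form of the Bayesian Truth Serum theorem. -/
theorem theorem6p5 {I Ω S : Type*} [MeasurableSpace I] [MeasurableSpace Ω] [Fintype S]
    [MeasurableSpace S] [MeasurableSingletonClass S] (E : BTS.Environment I Ω S) :
    -- the distribution of reported signals is the state of the world when everyone tells the truth
    (∀ᵐ x ∂E.P, E.reportDist E.truth x = E.W x) ∧
    -- the scores of each agent when everyone tells the truth
    (∀ i j, i ≠ j →
      E.informationScore E.truth i (E.truth.strategy i) = (E.infoTruth i j : EReal) ∧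
      E.predictionScore E.truth i (E.truth.strategy i) = -(E.infoTruth j i : EReal)) ∧
    -- the average scores in an arbitrary equilibrium
    (∀ α : ℝ, 0 < α → ∀ s, E.IsEquilibrium α s → ∀ i j,
      E.avgInformationScore s = (E.infoReport s j : EReal) ∧
      E.avgPredictionScore s = -(E.infoReport s i : EReal)) ∧
    -- truth-telling maximizes the average information score over all equilibria
    (∀ α : ℝ, 0 < α → E.IsEquilibrium α E.truth ∧ ∀ s, E.IsEquilibrium α s →
      E.avgInformationScore s ≤ E.avgInformationScore E.truth) ∧
    -- BTS is focal
    (∀ α : ℝ, 1 < α → E.IsFocal α) := by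
  -- the mutual information `J` as a difference of finite entropies
  have hsub : ∀ (s : BTS.Profile I S) (J : ENNReal),
      J + E.stateEntropy s = E.peerEntropy s →
      (E.peerEntropy s : EReal) - (E.stateEntropy s : EReal) = (J : EReal) ∧
      (E.stateEntropy s : EReal) - (E.peerEntropy s : EReal) = -(J : EReal) := by
    intro s J hJ
    have hH := E.stateEntropy_ne_top s
    have hC := E.peerEntropy_ne_top s
    rw [← hJ] at hC ⊢
    obtain ⟨hJt, -⟩ := ENNReal.add_ne_top.1 hC
    generalize E.stateEntropy s = H at *
    lift H to NNReal using hH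
    lift J to NNReal using hJt
    rw [← ENNReal.coe_add]
    simp only [EReal.coe_nnreal_eq_coe_real, ← EReal.coe_sub, ← EReal.coe_neg,
      EReal.coe_eq_coe_iff, NNReal.coe_add]
    constructor <;> ring
  have htruth := E.isCalibrated_truth
  have hreal : ∀ s : BTS.Profile I S,
      (E.peerEntropy s).toReal - (E.stateEntropy s).toReal ≤
        (E.peerEntropy E.truth).toReal - (E.stateEntropy E.truth).toReal := by
    intro s
    have h := ENNReal.toReal_mono (ENNReal.add_ne_top.2
      ⟨E.peerEntropy_ne_top E.truth, E.stateEntropy_ne_top s⟩)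
      (E.peerEntropy_add_stateEntropy_truth_le s)
    rw [ENNReal.toReal_add (E.peerEntropy_ne_top s) (E.stateEntropy_ne_top E.truth),
      ENNReal.toReal_add (E.peerEntropy_ne_top E.truth) (E.stateEntropy_ne_top s)] at h
    linarith
  have hcoe : ∀ s : BTS.Profile I S,
      (E.peerEntropy s : EReal) - (E.stateEntropy s : EReal) =
        (((E.peerEntropy s).toReal - (E.stateEntropy s).toReal : ℝ) : EReal) := by
    intro s
    rw [EReal.coe_sub, EReal.coe_ennreal_toReal (E.peerEntropy_ne_top s),
      EReal.coe_ennreal_toReal (E.stateEntropy_ne_top s)]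
  refine ⟨E.reportDist_truth, fun i j hij => ⟨?_, ?_⟩, fun α _ s hs i j => ⟨?_, ?_⟩,
    fun α hα => ⟨E.isEquilibrium_truth hα.le, fun s hs => ?_⟩,
    fun α hα => ⟨E.isEquilibrium_truth (by linarith), fun s hs => ?_⟩⟩
  · rw [E.informationScore_truth, (hsub _ _ (E.infoTruth_add_stateEntropy hij)).1]
  · rw [htruth.predictionScore_eq, (hsub _ _ (E.infoTruth_add_stateEntropy hij.symm)).2]
  · rw [hs.isCalibrated.avgInformationScore_eq, (hsub _ _ (E.infoReport_add_stateEntropy s j)).1]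
  · rw [hs.isCalibrated.avgPredictionScore_eq, (hsub _ _ (E.infoReport_add_stateEntropy s i)).2]
  · rw [hs.isCalibrated.avgInformationScore_eq, htruth.avgInformationScore_eq, hcoe, hcoe]
    exact EReal.coe_le_coe_iff.2 (hreal s)
  · rw [hs.isCalibrated.welfare_eq (by linarith), htruth.welfare_eq (by linarith)]
    exact EReal.coe_le_coe_iff.2 (mul_le_mul_of_nonneg_left (hreal s) (by linarith))
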